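/- **Setting.** Let $V$ be a finite vocabulary, $L\ge 0$ a block length and $K\ge 1$ a number of paths. A target model (in a fixed context) gives a next-token distribution $p(\cdot\mid a)$ on $V$ for every finite token sequence $a$; write $p(b\mid a)=\prod_j p(b_j\mid a,b_{1:j-1})$ and $p_n$ for the law of $n$ tokens sampled autoregressively. The draft distribution $q$ is a probability distribution on $V^L$. For a distribution $r$ on $V^L$ and $i\le L$, let $r(a_{1:i})$ be the probability that a path with law $r$ begins with $a_{1:i}$, and $r(x\mid a_{1:i})=r(a_{1:i},x)/r(a_{1:i})$ for $i<L$. A *$K$-path verification algorithm* $\Phi$ receives the next-token probabilities $p(\cdot\mid a)$ with $|a|\le L$, the distribution $q$, and $K$ i.i.d. drafts $X^{(1)},\dots,X^{(K)}\sim q$, and returns a random token sequence. It is *valid* if, for all $p$ and $q$: (prefix-matching) the output is $(X_{1:\tau},Y)$ with $X_{1:\tau}$ a prefix of one of the drafts, $0\le\tau\le L$, and $Y\in V$; (target-matching) appending $L-\tau$ further tokens sampled autoregressively from $p$ gives a sequence with law $p_{L+1}$. Its *block efficiency* is $\mathbb E[\tau+1]$. A valid algorithm is *optimal* if for all $p,q$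 no valid algorithm has larger block efficiency. A *path selection rule* $\Gamma$ chooses at random one of the $K$ drafts, depending on all drafts, on the probabilities $p(\cdot\mid a)$ with $|a|\le L$, and on $q$. The *skewed draft distribution* $q^\Gamma$ is the law on $V^L$ of the selected draft. *Single-path block verification* of a path $X\in V^L$ with target $p$ and draft $r$: put $w(\emptyset)=1$, $w(a_{1:i})=\min\{1,\,w(a_{1:i-1})\,p(a_i\mid a_{1:i-1})/r(a_i\mid a_{1:i-1})\}$ and $\rho(a)=\sum_{x\in V}\max\{w(a)p(x\mid a)-r(x\mid a),0\}$. Accept each prefix $X_{1:i}$, $1\le i\le L$, independently, with probability $\rho(X_{1:i})/(1-w(X_{1:i})+\rho(X_{1:i}))$ if $i<L$ (read as $0$ if this is $0/0$) and $w(X_{1:L})$ if $i=L$. Let $\tau$ be the length of the longest accepted prefix ($0$ if there is none). Output $X_{1:\tau}$ followed by a token drawn from the distribution proportional to $x\mapsto\max\{w(X_{1:\tau})p(x\mid X_{1:\tau})-r(x\mid X_{1:\tau}),0\}$ if $\tau<L$, and from $p(\cdot\mid X_{1:L})$ if $\tau=L$. For a path selection rule $\Gamma$ let $\mathrm{BV}_\Gamma$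 be the $K$-path algorithm that selects a draft with $\Gamma$ and then runs single-path block verification on it with target $p$ and draft $q^\Gamma$. **Theorem.** 1. $\mathrm{BV}_\Gamma$ is valid for every path selection rule $\Gamma$, and there is a $\Gamma$ for which $\mathrm{BV}_\Gamma$ is optimal among all valid $K$-path verification algorithms. Moreover, every optimal algorithm has, for all $p,q$, the same output law as $\mathrm{BV}_\Gamma$ for some $\Gamma$ with $\mathrm{BV}_\Gamma$ optimal. 2. For given $p,q$ consider the optimization problem over probability distributions $r$ on $V^L$: $$\max_r\ \sum_{i=0}^{L}\sum_{a_{1:i}\in V^i}\ \min_{0\le k\le i} p(a_{k+1:i}\mid a_{1:k})\,r(a_{1:k})\quad\text{s.t.}\quad 1-\sum_{a\in T}r(a)\ \ge\ \Bigl(1-\sum_{a\in T}q(a)\Bigr)^{K}\quad\forall\,T\subseteq V^L .$$ Its feasible points are exactly the skewed draft distributions $q^\Gamma$ of path selection rules; the objective at $r=q^\Gamma$ is the block efficiency of $\mathrm{BV}_\Gamma$; and $\mathrm{BV}_\Gamma$ is optimal if and only if, for all $p,q$, $q^\Gamma$ is a solution of this problem. -/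

import Mathlib

open scoped ENNReal

namespace SpecDec

noncomputable section

/-- A language model in a fixed context `c`: the next-token distribution `p(· | c, a)`
for every finite continuation `a` of the context. -/
abbrev Model (V : Type*) := List V → PMF V

/-- A path (draft block) `a_{1:L}` of length `L`. -/
abbrev Path (V : Type*) (L : ℕ) := Fin L → V

/-- The prefix `X_{1:i}` of a path. -/
def pre {V : Type*} {L : ℕ} (X : Path V L) (i : ℕ) : List V := (List.ofFn X).take i

theorem length_pre_le {V : Type*} {L : ℕ} (X : Path V L) (i : ℕ) : (pre X i).length ≤ L := by
  simp [pre]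

/-- Two models assign the same next-token distributions after at most `L` generated tokens. -/
def AgreeUpTo {V : Type*} (L : ℕ) (p p' : Model V) : Prop :=
  ∀ a : List V, a.length ≤ L → p a = p' a

/-- `gen p n a`: the law of `a` followed by `n` tokens sampled autoregressively from `p`. -/
def gen {V : Type*} (p : Model V) : ℕ → List V → PMF (List V)
  | 0, a => PMF.pure a
  | n + 1, a => (p a).bind fun x => gen p n (a ++ [x])

/-- `condProb p c a` is `p(a | c) = ∏ p(a_i | c, a_{1:i-1})`. -/
def condProb {V : Type*} (p : Model V) : List V → List V → ℝ
  | _, [] => 1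
  | c, x :: a => (p c x).toReal * condProb p (c ++ [x]) a

/-- The joint law of `K` independent samples from `q`. -/
def iid {α : Type*} [Fintype α] (q : PMF α) (K : ℕ) : PMF (Fin K → α) :=
  PMF.ofFintype (fun P => ∏ k, q (P k)) (by
    classical
    have h := Finset.prod_univ_sum (fun _ : Fin K => (Finset.univ : Finset α))
      (fun _ a => q a)
    rw [Fintype.piFinset_univ] at h
    rw [← h]
    have h1 : ∑ a, q a = 1 := by rw [← tsum_fintype (L := .unconditional _)]; exact q.tsum_coe
    simp [h1])

section Prefixes

variable {V : Type*} [Fintype V] [DecidableEq V] {L : ℕ}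

/-- The probability `r(a_{1:i})` that a path with law `r` begins with `a_{1:i}`. -/
def marginal (r : PMF (Path V L)) (a : List V) : ℝ :=
  ∑ X : Path V L with a <+: List.ofFn X, (r X).toReal

/-- The induced autoregressive probability `r(x | a)`. -/
def next (r : PMF (Path V L)) (a : List V) (x : V) : ℝ :=
  marginal r (a ++ [x]) / marginal r a

theorem marginal_nonneg (r : PMF (Path V L)) (a : List V) : 0 ≤ marginal r a :=
  Finset.sum_nonneg fun _ _ => ENNReal.toReal_nonneg

/-- Block verification weights, with target `p` and draft law `r`: `w(∅) = 1` and
`w(a_{1:i}) = min {1, w(a_{1:i-1}) p(a_i | a_{1:i-1}) / r(a_i | a_{1:i-1})}`. -/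
def weight (p : Model V) (r : PMF (Path V L)) (a : List V) : ℝ :=
  if h : a = [] then 1
  else min 1 (weight p r a.dropLast * (p a.dropLast (a.getLast h)).toReal /
    next r a.dropLast (a.getLast h))
termination_by a.length
decreasing_by
  have := List.length_pos_iff.2 h
  simp only [List.length_dropLast]
  omega

theorem weight_nil (p : Model V) (r : PMF (Path V L)) : weight p r [] = 1 := by
  rw [weight]; simp

theorem weight_concat (p : Model V) (r : PMF (Path V L)) (a : List V) (x : V) :
    weight p r (a ++ [x]) = min 1 (weight p r a * (p a x).toReal / next r a x) := by
  rw [weight]; simp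

theorem weight_le_one (p : Model V) (r : PMF (Path V L)) (a : List V) : weight p r a ≤ 1 := by
  rw [weight]; split_ifs
  · exact le_rfl
  · exact min_le_left _ _

theorem weight_nonneg (p : Model V) (r : PMF (Path V L)) (a : List V) : 0 ≤ weight p r a := by
  induction a using List.reverseRecOn with
  | nil => rw [weight_nil]; exact zero_le_one
  | append_singleton a x ih =>
    rw [weight_concat]
    exact le_min zero_le_one (div_nonneg (mul_nonneg ih ENNReal.toReal_nonneg)
      (div_nonneg (marginal_nonneg _ _) (marginal_nonneg _ _)))

/-- The unnormalized residual `max {w(a) p(x | a) - r(x | a), 0}`. -/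
def excess (p : Model V) (r : PMF (Path V L)) (a : List V) (x : V) : ℝ :=
  max (weight p r a * (p a x).toReal - next r a x) 0

/-- The probability with which block verification accepts the prefix `a`. -/
def accept (p : Model V) (r : PMF (Path V L)) (a : List V) : ℝ :=
  if a.length < L then
    (∑ x, excess p r a x) / (1 - weight p r a + ∑ x, excess p r a x)
  else weight p r a

theorem sum_excess_nonneg (p : Model V) (r : PMF (Path V L)) (a : List V) :
    0 ≤ ∑ x, excess p r a x :=
  Finset.sum_nonneg fun _ _ => le_max_right _ _

theorem accept_nonneg (p : Model V) (r : PMF (Path V L)) (a : List V) : 0 ≤ accept p r a := by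
  have h1 := sum_excess_nonneg p r a
  have h2 := weight_le_one p r a
  unfold accept; split_ifs
  · exact div_nonneg h1 (by linarith)
  · exact weight_nonneg p r a

theorem accept_le_one (p : Model V) (r : PMF (Path V L)) (a : List V) : accept p r a ≤ 1 := by
  have h1 := sum_excess_nonneg p r a
  have h2 := weight_le_one p r a
  unfold accept; split_ifs
  · exact div_le_one_of_le₀ (by linarith) (by linarith)
  · exact h2

/-- The random decision whether the prefix `a` is accepted. -/
def acceptCoin (p : Model V) (r : PMF (Path V L)) (a : List V) : PMF Bool :=
  PMF.ofFintype
    (fun b => bif b then ENNReal.ofReal (accept p r a) else ENNReal.ofReal (1 - accept p r a))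
    (by
      have h := accept_le_one p r a
      simp only [Fintype.univ_bool, Finset.mem_singleton, Bool.true_eq_false, not_false_eq_true,
        Finset.sum_insert, Finset.sum_singleton, cond_true, cond_false]
      rw [← ENNReal.ofReal_add (accept_nonneg p r a) (by linarith)]
      simp)

/-- The law of the length of the longest accepted prefix among `X_{1:1}, …, X_{1:i}`, each of
which is accepted independently; it is `0` if none is accepted. -/
def longestAccepted (p : Model V) (r : PMF (Path V L)) (X : Path V L) : ℕ → PMF ℕ
  | 0 => PMF.pure 0
  | i + 1 => (longestAccepted p r X i).bind fun t =>
      (acceptCoin p r (pre X (i + 1))).map fun b => bif b then i + 1 else t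

/-- The residual distribution, proportional to `x ↦ max {w(a) p(x | a) - r(x | a), 0}`. (If that
vector is zero, the prefix `a` is the output with probability zero, and the value is immaterial.) -/
def residual (p : Model V) (r : PMF (Path V L)) (a : List V) : PMF V :=
  open Classical in
  if h : ∑' x, ENNReal.ofReal (excess p r a x) = 0 then p a
  else PMF.normalize (fun x => ENNReal.ofReal (excess p r a x)) h
    (by rw [tsum_fintype]; exact ENNReal.sum_ne_top.2 fun _ _ => ENNReal.ofReal_ne_top)

/-- Single-path block verification of the path `X`, with target `p` and draft law `r`: the law of
`(X_{1:τ}, Y)`. -/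
def blockVerify (p : Model V) (r : PMF (Path V L)) (X : Path V L) : PMF (List V) :=
  (longestAccepted p r X L).bind fun t =>
    (if t < L then residual p r (pre X t) else p (pre X L)).map fun y => pre X t ++ [y]

theorem weight_congr {p p' : Model V} (h : AgreeUpTo L p p') (r : PMF (Path V L)) (a : List V)
    (ha : a.length ≤ L) : weight p r a = weight p' r a := by
  induction a using List.reverseRecOn with
  | nil => rw [weight_nil, weight_nil]
  | append_singleton a x ih =>
    have hl : a.length ≤ L := by simp only [List.length_append, List.length_singleton] at ha; omega
    rw [weight_concat, weight_concat, ih hl, h a hl]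

theorem excess_congr {p p' : Model V} (h : AgreeUpTo L p p') (r : PMF (Path V L)) (a : List V)
    (ha : a.length ≤ L) : excess p r a = excess p' r a := by
  funext x
  rw [excess, excess, weight_congr h r a ha, h a ha]

theorem acceptCoin_congr {p p' : Model V} (h : AgreeUpTo L p p') (r : PMF (Path V L))
    (a : List V) (ha : a.length ≤ L) : acceptCoin p r a = acceptCoin p' r a := by
  have e : accept p r a = accept p' r a := by
    simp only [accept, weight_congr h r a ha, excess_congr h r a ha]
  simp only [acceptCoin, e]

theorem residual_congr {p p' : Model V} (h : AgreeUpTo L p p') (r : PMF (Path V L))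
    (a : List V) (ha : a.length ≤ L) : residual p r a = residual p' r a := by
  simp only [residual, excess_congr h r a ha, h a ha]

theorem longestAccepted_congr {p p' : Model V} (h : AgreeUpTo L p p') (r : PMF (Path V L))
    (X : Path V L) (i : ℕ) : longestAccepted p r X i = longestAccepted p' r X i := by
  induction i with
  | zero => rfl
  | succ i ih =>
    simp only [longestAccepted, ih, acceptCoin_congr h r _ (length_pre_le X (i + 1))]

theorem blockVerify_congr {p p' : Model V} (h : AgreeUpTo L p p') (r : PMF (Path V L))
    (X : Path V L) : blockVerify p r X = blockVerify p' r X := by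
  simp only [blockVerify, longestAccepted_congr h, residual_congr h r _ (length_pre_le X _),
    h _ (length_pre_le X _)]

end Prefixes

/-- A `K`-path verification algorithm with block length `L`. It is given the `L`-step target
probabilities (`run_congr` says that nothing else about the target is used), the draft
distribution `q_L` on paths, and `K` draft blocks, and it returns a random sequence of tokens. -/
structure VerificationAlg (V : Type*) (L K : ℕ) where
  run : Model V → PMF (Path V L) → (Fin K → Path V L) → PMF (List V)
  run_congr : ∀ p p' q, AgreeUpTo L p p' → run p q = run p' q

/-- A randomized path selection rule: the index of the selected block, given the `L`-step target
and draft probabilities and all `K` draft blocks. -/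
structure SelectionRule (V : Type*) (L K : ℕ) where
  select : Model V → PMF (Path V L) → (Fin K → Path V L) → PMF (Fin K)
  select_congr : ∀ p p' q, AgreeUpTo L p p' → select p q = select p' q

variable {V : Type*} [Fintype V] {L K : ℕ}

/-- The law of the output of `Φ` on `K` i.i.d. draft blocks. -/
def VerificationAlg.outputLaw (Φ : VerificationAlg V L K) (p : Model V) (q : PMF (Path V L)) :
    PMF (List V) :=
  (iid q K).bind (Φ.run p q)

/-- The block efficiency `𝔼[τ + 1]`, the expected length of the output. -/
def VerificationAlg.blockEfficiency (Φ : VerificationAlg V L K) (p : Model V)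
    (q : PMF (Path V L)) : ℝ≥0∞ :=
  ∑' o : List V, Φ.outputLaw p q o * (o.length : ℝ≥0∞)

/-- The output is a prefix `X_{1:τ}`, `0 ≤ τ ≤ L`, of some draft block, followed by one token. -/
def VerificationAlg.PrefixMatching (Φ : VerificationAlg V L K) : Prop :=
  ∀ (p : Model V) (q : PMF (Path V L)) (X : Fin K → Path V L), iid q K X ≠ 0 →
    ∀ o : List V, Φ.run p q X o ≠ 0 → ∃ k : Fin K, ∃ τ ≤ L, ∃ y : V, o = pre (X k) τ ++ [y]

/-- Continuing the output with target samples up to `L + 1` tokens gives the law `p_{L+1}`. -/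
def VerificationAlg.TargetMatching (Φ : VerificationAlg V L K) : Prop :=
  ∀ (p : Model V) (q : PMF (Path V L)),
    ((Φ.outputLaw p q).bind fun o => gen p (L + 1 - o.length) o) = gen p (L + 1) []

def VerificationAlg.Valid (Φ : VerificationAlg V L K) : Prop :=
  Φ.PrefixMatching ∧ Φ.TargetMatching

/-- Valid, and of maximal block efficiency among all valid algorithms, for every target and draft. -/
def VerificationAlg.IsOptimal (Φ : VerificationAlg V L K) : Prop :=
  Φ.Valid ∧ ∀ Ψ : VerificationAlg V L K, Ψ.Valid →
    ∀ (p : Model V) (q : PMF (Path V L)), Ψ.blockEfficiency p q ≤ Φ.blockEfficiency p q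

/-- The law `q^Γ` of the block that is selected from `K` i.i.d. draft blocks. -/
def skewed (q : PMF (Path V L)) (γ : (Fin K → Path V L) → PMF (Fin K)) : PMF (Path V L) :=
  (iid q K).bind fun X => (γ X).map fun k => X k

/-- The skewed draft distribution `q^Γ` of a path selection rule. -/
def SelectionRule.skewedDraft (Γ : SelectionRule V L K) (p : Model V) (q : PMF (Path V L)) :
    PMF (Path V L) :=
  skewed q (Γ.select p q)

/-- Select one of the `K` draft blocks with `Γ`, then run single-path block verification on it
with target `p` and draft `q^Γ`. -/
def SelectionRule.thenBlockVerify [DecidableEq V] (Γ : SelectionRule V L K) :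
    VerificationAlg V L K where
  run p q X := (Γ.select p q X).bind fun k => blockVerify p (Γ.skewedDraft p q) (X k)
  run_congr p p' q h := by
    funext X
    simp only [SelectionRule.skewedDraft, Γ.select_congr p p' q h, blockVerify_congr h]

/-- `∑_{a_{1:i} ∈ V^{≤ L}} min_{0 ≤ k ≤ i} p(a_{k+1:i} | a_{1:k}) r(a_{1:k})`. -/
def objective [DecidableEq V] (p : Model V) (r : PMF (Path V L)) : ℝ :=
  ∑ i ∈ Finset.range (L + 1), ∑ a : Path V i,
    (Finset.range (i + 1)).inf' Finset.nonempty_range_add_one fun k =>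
      condProb p (pre a k) ((List.ofFn a).drop k) * marginal r (pre a k)

/-- The submodular constraints: `1 - ∑_T r ≥ (1 - ∑_T q)^K` for all `T ⊆ V^L`. -/
def Feasible (K : ℕ) (q r : PMF (Path V L)) : Prop :=
  ∀ T : Finset (Path V L),
    1 - ∑ a ∈ T, (r a).toReal ≥ (1 - ∑ a ∈ T, (q a).toReal) ^ K

end

end SpecDec

/-!
The theorem rests on a description of valid outputs by the numbers `strictMass o a`, the probability
that the output `(X_{1:τ}, Y)` satisfies `τ ≥ |a|` and `X_{1:|a|} = a`.

*Validity is local.* Completing an output with target samples gives the target law if and only if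
the output is calibrated: the probability that it begins with `a, x` is `strictMass o a * p(x | a)`
(`isCalibrated_iff`). In particular the numbers `strictMass o a` determine a calibrated law.

*Block verification is extremal.* For a path with law `r`, block verification has
`strictMass o a = r(a) w(a) = acceptedMass p r a` (`strictMass_bind_blockVerify`). These numbers
satisfy `acceptedMass (a, x) = min (r(a, x), acceptedMass a * p(x | a))`, which unfolds to the minimum
in the objective, and for `|a| < L` the output `(a, x)` has the probability
`acceptedMass a * p(x | a) - acceptedMass (a, x)`, which makes block verification calibrated
(`isCalibrated_bind_blockVerify`). Conversely, from any valid algorithm one selects a draft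
that matches the output; its law `r` dominates the proper prefixes of the output, and with
calibration the same recursion, now with `≤`, gives
`strictMass o a ≤ acceptedMass p r a` (`IsCalibrated.strictMass_le`). The mean output length is the
sum of all `strictMass o a` with `|a| ≤ L`. Hence the efficiency of a valid algorithm is at most the
objective at a skewed draft distribution, with equality only for the output law of block
verification (`IsCalibrated.eq_bind_blockVerify`).

*Feasibility.* The skewed draft distributions form a compact convex set of vectors, on which the
continuous objective has a maximum. A feasible `r` outside this set would be separated from it by a
linear functional; the selection of the draft with the largest value of that functional contradicts
this, since the constraints on the upper level sets compare the two means layer by layer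
(`mem_skewedSet_of_feasible`).
-/

namespace SpecDec

noncomputable section

/-! ### Autoregressive probabilities -/

section Autoregressive

variable {V : Type*}

/-- `p(a | c) = ∏ p(a_i | c, a_{1:i-1})` as an extended nonnegative real. -/
def condMass (p : Model V) : List V → List V → ℝ≥0∞
  | _, [] => 1
  | c, x :: a => p c x * condMass p (c ++ [x]) a

theorem condMass_concat (p : Model V) (c a : List V) (x : V) :
    condMass p c (a ++ [x]) = condMass p c a * p (c ++ a) x := by
  induction a generalizing c with
  | nil => simp [condMass]
  | cons y a ih => simp [condMass, ih, mul_assoc]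

theorem toReal_condMass (p : Model V) (c a : List V) :
    (condMass p c a).toReal = condProb p c a := by
  induction a generalizing c with
  | nil => simp [condMass, condProb]
  | cons y a ih => simp [condMass, condProb, ih]

theorem length_of_gen_ne_zero (p : Model V) (n : ℕ) (b z : List V) (h : gen p n b z ≠ 0) :
    z.length = b.length + n := by
  induction n generalizing b with
  | zero =>
    have : z = b := by simpa [gen, PMF.pure_apply] using h
    simp [this]
  | succ n ih =>
    rw [gen, ← PMF.mem_support_iff, PMF.mem_support_bind_iff] at h
    obtain ⟨x, -, hx⟩ := h
    have := ih _ ((PMF.mem_support_iff _ _).1 hx)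
    simp at this; omega

end Autoregressive

/-! ### Prefix probabilities of a random token sequence -/

section Sequences

variable {V : Type*} [DecidableEq V]

/-- The probability that a random sequence with law `o` has the prefix `c`. -/
def prefixMass (o : PMF (List V)) (c : List V) : ℝ≥0∞ :=
  ∑' b, if c <+: b then o b else 0

/-- The probability that a random sequence with law `o` has `c` as a proper prefix. For the output
`(X_{1:τ}, Y)` of a verification algorithm this is the probability that `τ ≥ |c|` and
`X_{1:|c|} = c`. -/
def strictMass (o : PMF (List V)) (c : List V) : ℝ≥0∞ :=
  ∑' b, if c <+: b ∧ c.length < b.length then o b else 0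

theorem prefixMass_le_one (o : PMF (List V)) (c : List V) : prefixMass o c ≤ 1 := by
  rw [← o.tsum_coe]
  refine ENNReal.tsum_le_tsum fun b => ?_
  split_ifs <;> simp

theorem prefixMass_nil (o : PMF (List V)) : prefixMass o [] = 1 := by
  simp [prefixMass, o.tsum_coe]

theorem prefixMass_eq_add (o : PMF (List V)) (c : List V) :
    prefixMass o c = o c + strictMass o c := by
  have h : o c = ∑' b, if b = c then o b else 0 := by rw [tsum_ite_eq]
  rw [h, prefixMass, strictMass, ← ENNReal.tsum_add]
  congr 1; funext b
  by_cases hb : b = c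
  · subst hb; simp
  · by_cases hp : c <+: b
    · have : c.length < b.length := lt_of_le_of_ne hp.length_le fun e => hb (hp.eq_of_length e).symm
      simp [hp, hb, this]
    · simp [hp, hb]

theorem strictMass_le_one (o : PMF (List V)) (c : List V) : strictMass o c ≤ 1 :=
  (le_add_self.trans (prefixMass_eq_add o c).ge).trans (prefixMass_le_one o c)

theorem strictMass_ne_top (o : PMF (List V)) (c : List V) : strictMass o c ≠ ⊤ :=
  ne_top_of_le_ne_top ENNReal.one_ne_top (strictMass_le_one o c)

theorem strictMass_eq_sum [Fintype V] (o : PMF (List V)) (a : List V) :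
    strictMass o a = ∑ x, prefixMass o (a ++ [x]) := by
  unfold prefixMass strictMass
  rw [← Summable.tsum_finsetSum fun _ _ => ENNReal.summable]
  congr 1; funext b
  by_cases hp : a <+: b
  · obtain ⟨t, rfl⟩ := hp
    cases t with
    | nil =>
      have : ∀ x, ¬ a ++ [x] <+: a := fun x h => by simpa using h.length_le
      simp [this]
    | cons y t =>
      simp [List.prefix_append_right_inj, List.cons_prefix_cons]
  · have : ∀ x, ¬ a ++ [x] <+: b := fun x h => hp ((List.prefix_append _ _).trans h)
    simp [hp, this]

theorem prefixMass_bind {α : Type*} (q : PMF α) (f : α → PMF (List V)) (c : List V) :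
    prefixMass (q.bind f) c = ∑' a, q a * prefixMass (f a) c := by
  unfold prefixMass
  simp_rw [← ENNReal.tsum_mul_left]
  rw [ENNReal.tsum_comm]
  congr 1; funext b
  split_ifs
  · simp [PMF.bind_apply]
  · simp

/-- The law of a random sequence is determined by its prefix probabilities. -/
theorem eq_of_prefixMass_eq [Fintype V] {o o' : PMF (List V)}
    (h : ∀ c, prefixMass o c = prefixMass o' c) : o = o' := by
  ext c
  have hs : strictMass o c = strictMass o' c := by simp only [strictMass_eq_sum, h]
  have e := h c
  rw [prefixMass_eq_add, prefixMass_eq_add, hs] at e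
  exact (ENNReal.add_left_inj (strictMass_ne_top o' c)).1 e

theorem prefixMass_eq_zero {o : PMF (List V)} {n : ℕ} (ho : ∀ b, o b ≠ 0 → b.length ≤ n)
    {c : List V} (hc : n < c.length) : prefixMass o c = 0 := by
  refine ENNReal.tsum_eq_zero.2 fun b => ?_
  split_ifs with hb
  · by_contra h
    have := ho b h
    have := hb.length_le
    omega
  · rfl

theorem strictMass_eq_zero {o : PMF (List V)} {n : ℕ} (ho : ∀ b, o b ≠ 0 → b.length ≤ n)
    {c : List V} (hc : n ≤ c.length) : strictMass o c = 0 := by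
  refine ENNReal.tsum_eq_zero.2 fun b => ?_
  split_ifs with hb
  · by_contra h
    have := ho b h
    omega
  · rfl

/-! ### Autoregressive continuation -/

/-- The probability that an autoregressive continuation of `b` has the prefix `c`, provided that it
is at least as long as `c`. -/
def hitMass (p : Model V) (b c : List V) : ℝ≥0∞ :=
  if c <+: b then 1 else if b <+: c then condMass p b (c.drop b.length) else 0

theorem prefixMass_gen [Fintype V] (p : Model V) (n : ℕ) (b c : List V)
    (h : c.length ≤ b.length + n) : prefixMass (gen p n b) c = hitMass p b c := by
  induction n generalizing b with
  | zero =>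
    have e : prefixMass (gen p 0 b) c = if c <+: b then 1 else 0 := by
      unfold prefixMass gen
      rw [tsum_eq_single b]
      · simp
      · intro b' hb'; simp [PMF.pure_apply, hb']
    rw [e, hitMass]
    split_ifs with h1 h2
    · rfl
    · exact (h1 (h2.eq_of_length_le (by simpa using h) ▸ List.prefix_rfl)).elim
    · rfl
  | succ n ih =>
    rw [gen, prefixMass_bind, tsum_fintype]
    simp_rw [fun x => ih (b ++ [x]) (by simp; omega)]
    by_cases h1 : c <+: b
    · have h2 : ∀ x, hitMass p (b ++ [x]) c = 1 := fun x =>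
        if_pos (h1.trans (List.prefix_append _ _))
      have h3 : ∑ x, p b x = 1 := by rw [← tsum_fintype (L := .unconditional _), (p b).tsum_coe]
      simp only [h2, mul_one, h3]
      rw [hitMass, if_pos h1]
    · by_cases h2 : b <+: c
      · obtain ⟨t, rfl⟩ := h2
        cases t with
        | nil => simp at h1
        | cons y t =>
          rw [Finset.sum_eq_single y]
          · have h3 : hitMass p (b ++ [y]) (b ++ y :: t) = condMass p (b ++ [y]) t := by
              unfold hitMass
              cases t with
              | nil => simp [condMass]
              | cons z t =>
                have h4 : ¬ (b ++ y :: z :: t <+: b ++ [y]) := fun h => by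
                  have := h.length_le; simp at this
                have h5 : b ++ [y] <+: b ++ y :: z :: t := by simp [List.prefix_append_right_inj]
                rw [if_neg h4, if_pos h5]
                congr 1
                simp
            rw [h3, hitMass, if_neg h1, if_pos (List.prefix_append _ _)]
            simp [condMass]
          · intro x _ hx
            have h4 : ¬ (b ++ y :: t <+: b ++ [x]) := fun h => by
              rw [List.prefix_append_right_inj, List.cons_prefix_cons] at h
              exact hx h.1.symm
            have h5 : ¬ (b ++ [x] <+: b ++ y :: t) := fun h => by
              rw [List.prefix_append_right_inj, List.cons_prefix_cons] at h
              exact hx h.1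
            simp [hitMass, h4, h5]
          · simp
      · have h3 : ∀ x, hitMass p (b ++ [x]) c = 0 := fun x => by
          have h4 : ¬ (c <+: b ++ [x]) := fun h => by
            rcases List.prefix_concat_iff.1 h with rfl | h
            · exact h2 (List.prefix_append _ _)
            · exact h1 h
          have h5 : ¬ (b ++ [x] <+: c) := fun h => h2 ((List.prefix_append _ _).trans h)
          simp [hitMass, h4, h5]
        simp only [h3, mul_zero, Finset.sum_const_zero]
        rw [hitMass, if_neg h1, if_neg h2]

/-- The contribution to the prefix probability of `c` in the completed sequence that comes from
outputs which are prefixes of `c` and have to be continued by target samples. -/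
def continuedMass (p : Model V) (o : PMF (List V)) (c : List V) : ℝ≥0∞ :=
  ∑' b, if b <+: c then o b * condMass p b (c.drop b.length) else 0

theorem continuedMass_nil (p : Model V) (o : PMF (List V)) : continuedMass p o [] = o [] := by
  unfold continuedMass
  rw [tsum_eq_single []]
  · simp [condMass]
  · intro b hb; simp [hb]

theorem continuedMass_concat (p : Model V) (o : PMF (List V)) (a : List V) (x : V) :
    continuedMass p o (a ++ [x]) = o (a ++ [x]) + continuedMass p o a * p a x := by
  have h : o (a ++ [x]) = ∑' b, if b = a ++ [x] then o b else 0 := by rw [tsum_ite_eq]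
  rw [h, continuedMass, continuedMass, ← ENNReal.tsum_mul_right, ← ENNReal.tsum_add]
  congr 1; funext b
  by_cases hb : b = a ++ [x]
  · subst hb
    have : ¬ (a ++ [x] <+: a) := fun h => by have := h.length_le; simp at this
    simp [this, condMass]
  · by_cases hp : b <+: a
    · obtain ⟨t, rfl⟩ := hp
      have h1 : b <+: b ++ t ++ [x] := by simp [List.append_assoc]
      have h2 : (b ++ t ++ [x]).drop b.length = t ++ [x] := by simp [List.append_assoc]
      rw [if_pos h1, if_neg hb, if_pos (List.prefix_append _ _), h2, condMass_concat, mul_assoc]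
      simp
    · have : ¬ (b <+: a ++ [x]) := fun h => by
        rcases List.prefix_concat_iff.1 h with h | h
        exacts [hb h, hp h]
      simp [hb, hp, this]

/-- A prefix of the completed sequence is either a proper prefix of the output, or an extension of
the output by target samples. -/
theorem prefixMass_complete [Fintype V] (p : Model V) (o : PMF (List V)) {L : ℕ} {c : List V}
    (hc : c.length ≤ L + 1) :
    prefixMass (o.bind fun b => gen p (L + 1 - b.length) b) c =
      strictMass o c + continuedMass p o c := by
  rw [prefixMass_bind, strictMass, continuedMass, ← ENNReal.tsum_add]
  congr 1; funext b
  rw [prefixMass_gen _ _ _ _ (by omega), hitMass]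
  by_cases h1 : c <+: b
  · by_cases h2 : b <+: c
    · have : c = b := h1.eq_of_length_le h2.length_le
      subst this
      simp [condMass]
    · have : c.length < b.length := lt_of_le_of_ne h1.length_le fun e =>
        h2 (h1.eq_of_length e ▸ List.prefix_rfl)
      simp [h1, h2, this]
  · simp [h1]

/-- The output law `o` has length at most `L + 1`, and each token that is output after `a` is
distributed as the target prescribes, given that the output properly extends `a`. -/
structure IsCalibrated (p : Model V) (L : ℕ) (o : PMF (List V)) : Prop where
  length_le : ∀ b, o b ≠ 0 → b.length ≤ L + 1
  step : ∀ a x, a.length ≤ L → prefixMass o (a ++ [x]) = strictMass o a * p a x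

/-- Completing a sequence with target samples gives the target law if and only if the sequence is
calibrated. The contributions of the continued outputs evolve by the target's own recursion and
cancel. -/
theorem isCalibrated_iff [Fintype V] (p : Model V) (L : ℕ) (o : PMF (List V)) :
    IsCalibrated p L o ↔ (∀ b, o b ≠ 0 → b.length ≤ L + 1) ∧
      (o.bind fun b => gen p (L + 1 - b.length) b) = gen p (L + 1) [] := by
  have hgen : ∀ c : List V, c.length ≤ L + 1 →
      prefixMass (gen p (L + 1) []) c = condMass p [] c := fun c hc => by
    rw [prefixMass_gen _ _ _ _ (by simpa using hc), hitMass]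
    cases c <;> simp [condMass]
  constructor
  · intro h
    refine ⟨h.length_le, eq_of_prefixMass_eq fun c => ?_⟩
    by_cases hc : c.length ≤ L + 1
    · rw [prefixMass_complete _ _ hc, hgen c hc]
      induction c using List.reverseRecOn with
      | nil =>
        rw [continuedMass_nil, add_comm, ← prefixMass_eq_add, prefixMass_nil]
        rfl
      | append_singleton a x ih =>
        have ha : a.length ≤ L := by simpa using hc
        rw [continuedMass_concat, ← add_assoc, add_comm (strictMass _ _), ← prefixMass_eq_add,
          h.step a x ha, ← add_mul, ih (by omega), condMass_concat, List.nil_append]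
    · rw [not_le] at hc
      rw [prefixMass_eq_zero _ hc, prefixMass_eq_zero _ hc]
      · intro z hz
        simpa using (length_of_gen_ne_zero p _ _ z hz).le
      · intro z hz
        rw [← PMF.mem_support_iff, PMF.mem_support_bind_iff] at hz
        obtain ⟨b, hb, hz⟩ := hz
        have h1 := h.length_le b ((PMF.mem_support_iff _ _).1 hb)
        have h2 := length_of_gen_ne_zero p _ _ z ((PMF.mem_support_iff _ _).1 hz)
        omega
  · rintro ⟨hl, h⟩
    refine ⟨hl, fun a x ha => ?_⟩
    have h1 := prefixMass_complete p o (L := L) (c := a ++ [x]) (by simpa using ha)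
    have h2 := prefixMass_complete p o (L := L) (c := a) (by omega)
    rw [h, hgen _ (by simpa using ha), condMass_concat, List.nil_append,
      ← hgen a (by omega), ← h, h2, continuedMass_concat, ← add_assoc, add_mul,
      add_comm (strictMass o (a ++ [x])), ← prefixMass_eq_add] at h1
    refine ((ENNReal.add_left_inj ?_).1 h1).symm
    refine ENNReal.mul_ne_top ?_ ((p a).apply_ne_top x)
    rw [h] at h2
    exact ne_top_of_le_ne_top ENNReal.one_ne_top
      ((le_add_self.trans h2.ge).trans (prefixMass_le_one _ _))

theorem IsCalibrated.eq_of_strictMass_eq [Fintype V] {p : Model V} {L : ℕ} {o o' : PMF (List V)}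
    (h : IsCalibrated p L o) (h' : IsCalibrated p L o')
    (e : ∀ a : List V, a.length ≤ L → strictMass o a = strictMass o' a) : o = o' := by
  refine eq_of_prefixMass_eq fun c => ?_
  induction c using List.reverseRecOn with
  | nil => rw [prefixMass_nil, prefixMass_nil]
  | append_singleton a x _ =>
    by_cases ha : a.length ≤ L
    · rw [h.step a x ha, h'.step a x ha, e a ha]
    · rw [prefixMass_eq_zero h.length_le (by simpa using ha),
        prefixMass_eq_zero h'.length_le (by simpa using ha)]

end Sequences

/-! ### Single-path block verification -/

section BlockVerification

theorem length_pre {V : Type*} {L : ℕ} {X : Path V L} {i : ℕ} (h : i ≤ L) :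
    (pre X i).length = i := by
  simpa [pre] using h

theorem pre_eq_iff {V : Type*} {L : ℕ} {X : Path V L} {a : List V} :
    pre X a.length = a ↔ a <+: List.ofFn X := by
  rw [List.prefix_iff_eq_take, pre, eq_comm]

theorem sum_toReal {V : Type*} [Fintype V] (m : PMF V) : ∑ x, (m x).toReal = 1 := by
  rw [← ENNReal.toReal_sum fun x _ => m.apply_ne_top x, ← tsum_fintype (L := .unconditional _),
    m.tsum_coe, ENNReal.toReal_one]

variable {V : Type*} [Fintype V] [DecidableEq V] {L : ℕ}

/-- A path of length `L` that begins with `a`, `|a| < L`, has exactly one next token. -/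
theorem sum_prefix_split (F : Path V L → ℝ) {a : List V} (ha : a.length < L) :
    ∑ X : Path V L with a <+: List.ofFn X, F X =
      ∑ x, ∑ X : Path V L with a ++ [x] <+: List.ofFn X, F X := by
  simp_rw [Finset.sum_filter]
  rw [Finset.sum_comm]
  refine Finset.sum_congr rfl fun X _ => ?_
  by_cases hp : a <+: List.ofFn X
  · obtain ⟨t, ht⟩ := hp
    rw [← ht]
    cases t with
    | nil =>
      have := congrArg List.length ht
      simp at this; omega
    | cons y t => simp [List.prefix_append_right_inj, List.cons_prefix_cons]
  · have : ∀ x, ¬ a ++ [x] <+: List.ofFn X := fun x h => hp ((List.prefix_append _ _).trans h)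
    simp [hp, this]

theorem marginal_nil (r : PMF (Path V L)) : marginal r [] = 1 := by
  simpa [marginal] using sum_toReal r

theorem sum_marginal_concat (r : PMF (Path V L)) {a : List V} (ha : a.length < L) :
    ∑ x, marginal r (a ++ [x]) = marginal r a :=
  (sum_prefix_split _ ha).symm

theorem marginal_append_le (r : PMF (Path V L)) (a t : List V) :
    marginal r (a ++ t) ≤ marginal r a := by
  refine Finset.sum_le_sum_of_subset_of_nonneg (fun X hX => ?_) fun _ _ _ => ENNReal.toReal_nonneg
  simp only [Finset.mem_filter, Finset.mem_univ, true_and] at hX ⊢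
  exact (List.prefix_append _ _).trans hX

theorem marginal_mul_next (r : PMF (Path V L)) (a : List V) (x : V) :
    marginal r a * next r a x = marginal r (a ++ [x]) := by
  by_cases h : marginal r a = 0
  · have := marginal_append_le r a [x]
    have := marginal_nonneg r (a ++ [x])
    rw [h, zero_mul]; linarith
  · rw [next, mul_div_cancel₀ _ h]

/-- The probability that a path with law `r` begins with `a` and that block verification accepts
at least `a`. -/
def acceptedMass (p : Model V) (r : PMF (Path V L)) (a : List V) : ℝ :=
  marginal r a * weight p r a

theorem acceptedMass_nonneg (p : Model V) (r : PMF (Path V L)) (a : List V) :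
    0 ≤ acceptedMass p r a :=
  mul_nonneg (marginal_nonneg r a) (weight_nonneg p r a)

theorem acceptedMass_nil (p : Model V) (r : PMF (Path V L)) : acceptedMass p r [] = 1 := by
  rw [acceptedMass, marginal_nil, weight_nil, one_mul]

theorem acceptedMass_le_marginal (p : Model V) (r : PMF (Path V L)) (a : List V) :
    acceptedMass p r a ≤ marginal r a :=
  mul_le_of_le_one_right (marginal_nonneg r a) (weight_le_one p r a)

/-- Where the draft has positive mass, the recursion for `weight` becomes, after multiplication by
the marginals, a recursion without divisions; elsewhere both sides vanish. -/
theorem acceptedMass_concat (p : Model V) (r : PMF (Path V L)) (a : List V) (x : V) :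
    acceptedMass p r (a ++ [x]) =
      min (marginal r (a ++ [x])) (acceptedMass p r a * (p a x).toReal) := by
  have h0 : 0 ≤ acceptedMass p r a * (p a x).toReal :=
    mul_nonneg (acceptedMass_nonneg p r a) ENNReal.toReal_nonneg
  rcases (marginal_nonneg r (a ++ [x])).eq_or_lt with h | h
  · rw [← h, min_eq_left h0, acceptedMass, ← h, zero_mul]
  · have ha : 0 < marginal r a := h.trans_le (marginal_append_le r a [x])
    rw [acceptedMass, weight_concat, mul_min_of_nonneg _ _ h.le, mul_one, acceptedMass, next]
    congr 1
    field_simp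

theorem marginal_mul_excess (p : Model V) (r : PMF (Path V L)) (a : List V) (x : V) :
    marginal r a * excess p r a x =
      acceptedMass p r a * (p a x).toReal - acceptedMass p r (a ++ [x]) := by
  rw [excess, mul_max_of_nonneg _ _ (marginal_nonneg r a), mul_sub, marginal_mul_next,
    acceptedMass_concat, mul_zero, ← mul_assoc, ← acceptedMass]
  rcases le_total (marginal r (a ++ [x])) (acceptedMass p r a * (p a x).toReal) with h | h
  · rw [max_eq_left (by linarith), min_eq_left h]
  · rw [max_eq_right (by linarith), min_eq_right h, sub_self]

theorem marginal_mul_sum_excess (p : Model V) (r : PMF (Path V L)) (a : List V) :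
    marginal r a * ∑ x, excess p r a x =
      acceptedMass p r a - ∑ x, acceptedMass p r (a ++ [x]) := by
  rw [Finset.mul_sum]
  simp_rw [marginal_mul_excess]
  rw [Finset.sum_sub_distrib, ← Finset.mul_sum, sum_toReal, mul_one]

theorem longestAccepted_succ (p : Model V) (r : PMF (Path V L)) (X : Path V L) (n i : ℕ) :
    longestAccepted p r X (n + 1) i =
      (if i = n + 1 then ENNReal.ofReal (accept p r (pre X (n + 1))) else 0) +
        longestAccepted p r X n i * ENNReal.ofReal (1 - accept p r (pre X (n + 1))) := by
  have hm : ∀ t : ℕ, ((acceptCoin p r (pre X (n + 1))).map fun b => bif b then n + 1 else t) i =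
      (if i = n + 1 then ENNReal.ofReal (accept p r (pre X (n + 1))) else 0) +
        if t = i then ENNReal.ofReal (1 - accept p r (pre X (n + 1))) else 0 := fun t => by
    rw [PMF.map_apply, tsum_bool, add_comm]
    simp only [acceptCoin, PMF.ofFintype_apply, cond_true, cond_false, eq_comm]
    split_ifs <;> simp
  rw [longestAccepted, PMF.bind_apply]
  simp_rw [hm, mul_add, ENNReal.tsum_add, ENNReal.tsum_mul_right, PMF.tsum_coe, one_mul]
  congr 1
  rw [tsum_eq_single i]
  · simp
  · intro t ht; simp [ht]

theorem longestAccepted_eq_zero (p : Model V) (r : PMF (Path V L)) (X : Path V L) {n i : ℕ}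
    (h : n < i) : longestAccepted p r X n i = 0 := by
  induction n with
  | zero => simp [longestAccepted, PMF.pure_apply]; omega
  | succ n ih => rw [longestAccepted_succ, ih (by omega), if_neg (by omega), zero_mul, add_zero]

/-- The longest accepted prefix has length `i` if `X_{1:i}` is accepted and no longer one is. The
value `0` is the default, so for `i = 0` there is no acceptance factor. -/
theorem toReal_longestAccepted (p : Model V) (r : PMF (Path V L)) (X : Path V L) {n i : ℕ}
    (h : i ≤ n) : (longestAccepted p r X n i).toReal =
      (if i = 0 then 1 else accept p r (pre X i)) *
        ∏ j ∈ Finset.Ioc i n, (1 - accept p r (pre X j)) := by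
  induction n with
  | zero =>
    obtain rfl : i = 0 := by omega
    simp [longestAccepted]
  | succ n ih =>
    have h1 := accept_le_one p r (pre X (n + 1))
    rw [longestAccepted_succ]
    rcases h.eq_or_lt with rfl | h
    · rw [longestAccepted_eq_zero _ _ _ (Nat.lt_succ_self n)]
      simp [ENNReal.toReal_ofReal (accept_nonneg p r _)]
    · rw [if_neg h.ne, zero_add, ENNReal.toReal_mul, ih (by omega),
        ENNReal.toReal_ofReal (by linarith), Finset.prod_Ioc_succ_top (by omega), mul_assoc]

/-- The probability that a path with law `r` begins with `a` and that block verification accepts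
none of its prefixes longer than `a`. -/
def rejectMass (p : Model V) (r : PMF (Path V L)) (a : List V) : ℝ :=
  ∑ X : Path V L with a <+: List.ofFn X,
    (r X).toReal * ∏ j ∈ Finset.Ioc a.length L, (1 - accept p r (pre X j))

theorem rejectMass_of_length_eq (p : Model V) (r : PMF (Path V L)) {a : List V}
    (ha : a.length = L) : rejectMass p r a = marginal r a := by
  simp [rejectMass, marginal, ha]

theorem rejectMass_eq_sum (p : Model V) (r : PMF (Path V L)) {a : List V} (ha : a.length < L) :
    rejectMass p r a = ∑ x, (1 - accept p r (a ++ [x])) * rejectMass p r (a ++ [x]) := by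
  rw [rejectMass, sum_prefix_split _ ha]
  refine Finset.sum_congr rfl fun x _ => ?_
  rw [rejectMass, Finset.mul_sum]
  refine Finset.sum_congr rfl fun X hX => ?_
  have hX := pre_eq_iff.2 (Finset.mem_filter.1 hX).2
  rw [← Finset.insert_Ioc_add_one_left_eq_Ioc ha, Finset.prod_insert (by simp)]
  simp only [List.length_append, List.length_singleton] at hX ⊢
  rw [hX]
  ring

/-- The acceptance probabilities are chosen so that, given that a path begins with `a`, at least
`a` is accepted with probability `weight p r a`. Here this is stated for the complementary event,
and proved by downward induction on the length of `a`. -/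
theorem one_sub_accept_mul_rejectMass (p : Model V) (r : PMF (Path V L)) (a : List V)
    (ha : a.length ≤ L) :
    (1 - accept p r a) * rejectMass p r a = marginal r a * (1 - weight p r a) ∧
      (a.length < L → rejectMass p r a =
        marginal r a * (1 - weight p r a + ∑ x, excess p r a x)) := by
  induction hn : L - a.length generalizing a with
  | zero =>
    refine ⟨?_, fun h => by omega⟩
    rw [rejectMass_of_length_eq p r (by omega), accept, if_neg (by omega), mul_comm]
  | succ n ih =>
    have hl : a.length < L := by omega
    have h1 : rejectMass p r a = marginal r a * (1 - weight p r a + ∑ x, excess p r a x) := by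
      rw [rejectMass_eq_sum p r hl, Finset.sum_congr rfl fun x _ =>
        (ih (a ++ [x]) (by simp; omega) (by simp; omega)).1]
      have hc : ∀ c, marginal r c * (1 - weight p r c) = marginal r c - acceptedMass p r c :=
        fun c => by rw [acceptedMass]; ring
      simp_rw [hc]
      rw [Finset.sum_sub_distrib, sum_marginal_concat r hl, mul_add, marginal_mul_sum_excess,
        acceptedMass]
      ring
    refine ⟨?_, fun _ => h1⟩
    have hw := weight_le_one p r a
    have he := sum_excess_nonneg p r a
    rw [h1, accept, if_pos hl]
    -- When the denominator of `accept` vanishes, it has the value `0`, and both sides are `0`.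
    by_cases hz : 1 - weight p r a + ∑ x, excess p r a x = 0
    · have : 1 - weight p r a = 0 := by linarith
      rw [hz, this]; simp
    · field_simp
      ring

/-- The law of the token that block verification outputs after the accepted prefix `a`. -/
def lastToken (p : Model V) (r : PMF (Path V L)) (a : List V) : PMF V :=
  if a.length < L then residual p r a else p a

theorem sum_excess_mul_residual (p : Model V) (r : PMF (Path V L)) (a : List V) (x : V) :
    (∑ y, excess p r a y) * (residual p r a x).toReal = excess p r a x := by
  have hn : ∀ y, 0 ≤ excess p r a y := fun y => le_max_right _ _
  have hs : ∑' y, ENNReal.ofReal (excess p r a y) = ENNReal.ofReal (∑ y, excess p r a y) := by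
    rw [tsum_fintype, ENNReal.ofReal_sum_of_nonneg fun y _ => hn y]
  unfold residual
  split_ifs with h
  · rw [hs, ENNReal.ofReal_eq_zero] at h
    have h0 : ∑ y, excess p r a y = 0 := le_antisymm h (sum_excess_nonneg p r a)
    have := (Finset.sum_eq_zero_iff_of_nonneg fun y _ => hn y).1 h0 x (Finset.mem_univ x)
    rw [h0, this, zero_mul]
  · rw [hs, ENNReal.ofReal_eq_zero, not_le] at h
    rw [PMF.normalize_apply, hs, ENNReal.toReal_mul, ENNReal.toReal_inv,
      ENNReal.toReal_ofReal h.le, ENNReal.toReal_ofReal (hn x)]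
    field_simp

theorem blockVerify_concat (p : Model V) (r : PMF (Path V L)) (X : Path V L) {a : List V} (x : V)
    (ha : a.length ≤ L) : blockVerify p r X (a ++ [x]) =
      if a <+: List.ofFn X then longestAccepted p r X L a.length * lastToken p r a x else 0 := by
  rw [blockVerify, PMF.bind_apply, tsum_eq_single a.length]
  · rw [PMF.map_apply]
    by_cases hp : a <+: List.ofFn X
    · have hX := pre_eq_iff.2 hp
      rw [if_pos hp]
      congr 1
      rw [tsum_eq_single x]
      · by_cases hl : a.length < L
        · simp [hX, lastToken, hl]
        · have : a.length = L := by omega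
          have hL : pre X L = a := (congrArg (pre X) this).symm.trans hX
          simp [lastToken, hl, hX, hL]
      · intro y hy
        simp [hX, hy.symm]
    · have hX := fun h => hp (pre_eq_iff.1 h)
      have : ∀ y, a ++ [x] ≠ pre X a.length ++ [y] := fun y h =>
        hX (List.append_inj_left' h rfl).symm
      simp [this, hp]
  · intro t ht
    by_cases htL : t ≤ L
    · rw [PMF.map_apply]
      have : ∀ y, a ++ [x] ≠ pre X t ++ [y] := fun y h => ht <| by
        rw [List.append_inj_left' h rfl, length_pre htL]
      simp [this]
    · rw [longestAccepted_eq_zero p r X (by omega), zero_mul]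

theorem blockVerify_support (p : Model V) (r : PMF (Path V L)) (X : Path V L) {o : List V}
    (ho : blockVerify p r X o ≠ 0) : ∃ t ≤ L, ∃ y, o = pre X t ++ [y] := by
  rw [← PMF.mem_support_iff, blockVerify, PMF.mem_support_bind_iff] at ho
  obtain ⟨t, ht, ho⟩ := ho
  rw [PMF.mem_support_map_iff] at ho
  obtain ⟨y, -, rfl⟩ := ho
  refine ⟨t, ?_, y, rfl⟩
  by_contra h
  exact (PMF.mem_support_iff _ _).1 ht (longestAccepted_eq_zero p r X (by omega))

theorem toReal_bind_blockVerify_concat (p : Model V) (r : PMF (Path V L)) {a : List V} (x : V)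
    (ha : a.length ≤ L) : ((r.bind (blockVerify p r)) (a ++ [x])).toReal =
      (if a.length = 0 then 1 else accept p r a) * rejectMass p r a *
        (lastToken p r a x).toReal := by
  rw [PMF.bind_apply, tsum_fintype, ENNReal.toReal_sum fun X _ =>
    ENNReal.mul_ne_top (r.apply_ne_top X) (PMF.apply_ne_top _ _), rejectMass, Finset.mul_sum,
    Finset.sum_mul, Finset.sum_filter]
  refine Finset.sum_congr rfl fun X _ => ?_
  rw [blockVerify_concat p r X x ha]
  by_cases hp : a <+: List.ofFn X
  · rw [if_pos hp, if_pos hp, ENNReal.toReal_mul, ENNReal.toReal_mul,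
      toReal_longestAccepted p r X ha, pre_eq_iff.2 hp]
    simp only [List.length_eq_zero_iff]
    ring
  · simp [hp]

/-- The probability of the output `a ++ [x]` of block verification. -/
theorem toReal_bind_blockVerify (p : Model V) (r : PMF (Path V L)) {a : List V} (x : V)
    (ha : a.length ≤ L) : ((r.bind (blockVerify p r)) (a ++ [x])).toReal =
      acceptedMass p r a * (p a x).toReal -
        if a.length < L then acceptedMass p r (a ++ [x]) else 0 := by
  rw [toReal_bind_blockVerify_concat p r x ha]
  obtain ⟨h1, h2⟩ := one_sub_accept_mul_rejectMass p r a ha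
  have hw := weight_le_one p r a
  have he := sum_excess_nonneg p r a
  split_ifs with h0 hl hl
  · obtain rfl := List.length_eq_zero_iff.1 h0
    rw [h2 hl, lastToken, if_pos hl, weight_nil, sub_self, zero_add, one_mul, mul_assoc,
      sum_excess_mul_residual, marginal_mul_excess]
  · obtain rfl := List.length_eq_zero_iff.1 h0
    rw [rejectMass_of_length_eq p r (by omega), lastToken, if_neg hl, acceptedMass, weight_nil]
    ring
  · have : accept p r a * rejectMass p r a = marginal r a * ∑ y, excess p r a y := by
      linarith [h2 hl]
    rw [this, lastToken, if_pos hl, mul_assoc, sum_excess_mul_residual, marginal_mul_excess]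
  · rw [rejectMass_of_length_eq p r (by omega), lastToken, if_neg hl, accept, if_neg hl,
      acceptedMass]
    ring

theorem length_le_of_bind_blockVerify (p : Model V) (r : PMF (Path V L)) (b : List V)
    (hb : (r.bind (blockVerify p r)) b ≠ 0) : b.length ≤ L + 1 := by
  rw [← PMF.mem_support_iff, PMF.mem_support_bind_iff] at hb
  obtain ⟨X, -, hb⟩ := hb
  obtain ⟨t, ht, y, rfl⟩ := blockVerify_support p r X ((PMF.mem_support_iff _ _).1 hb)
  simp [length_pre ht, ht]

/-- On a path drawn from `r`, block verification properly extends `a` with probability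
`acceptedMass p r a`. -/
theorem strictMass_bind_blockVerify (p : Model V) (r : PMF (Path V L)) (a : List V)
    (ha : a.length ≤ L) :
    strictMass (r.bind (blockVerify p r)) a = ENNReal.ofReal (acceptedMass p r a) ∧
      ∀ x, prefixMass (r.bind (blockVerify p r)) (a ++ [x]) =
        ENNReal.ofReal (acceptedMass p r a * (p a x).toReal) := by
  induction hn : L - a.length using Nat.strong_induction_on generalizing a with
  | _ n ih =>
    have h1 : ∀ x, prefixMass (r.bind (blockVerify p r)) (a ++ [x]) =
        ENNReal.ofReal (acceptedMass p r a * (p a x).toReal) := fun x => by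
      have ho := toReal_bind_blockVerify p r x ha
      rw [prefixMass_eq_add, ← ENNReal.ofReal_toReal (PMF.apply_ne_top _ _), ho]
      split_ifs with hl
      · rw [(ih (n - 1) (by omega) (a ++ [x]) (by simp; omega) (by simp; omega)).1,
          ← ENNReal.ofReal_add _ (acceptedMass_nonneg _ _ _), sub_add_cancel]
        rw [← marginal_mul_excess]
        exact mul_nonneg (marginal_nonneg _ _) (le_max_right _ _)
      · rw [strictMass_eq_zero (length_le_of_bind_blockVerify p r) (by simp; omega), sub_zero,
          add_zero]
    refine ⟨?_, h1⟩
    rw [strictMass_eq_sum]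
    simp_rw [h1]
    rw [← ENNReal.ofReal_sum_of_nonneg fun x _ =>
      mul_nonneg (acceptedMass_nonneg _ _ _) ENNReal.toReal_nonneg, ← Finset.mul_sum, sum_toReal,
      mul_one]

theorem isCalibrated_bind_blockVerify (p : Model V) (r : PMF (Path V L)) :
    IsCalibrated p L (r.bind (blockVerify p r)) where
  length_le := length_le_of_bind_blockVerify p r
  step a x ha := by
    obtain ⟨h1, h2⟩ := strictMass_bind_blockVerify p r a ha
    rw [h1, h2, ENNReal.ofReal_mul (acceptedMass_nonneg _ _ _),
      ENNReal.ofReal_toReal ((p a).apply_ne_top x)]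

end BlockVerification

/-! ### Block efficiency -/

section Efficiency

variable {V : Type*} [Fintype V] [DecidableEq V] {L K : ℕ}

theorem condProb_concat {V : Type*} (p : Model V) (c a : List V) (x : V) :
    condProb p c (a ++ [x]) = condProb p c a * (p (c ++ a) x).toReal := by
  simp only [← toReal_condMass, condMass_concat, ENNReal.toReal_mul]

theorem acceptedMass_append_le (p : Model V) (r : PMF (Path V L)) (b t : List V) :
    acceptedMass p r (b ++ t) ≤ condProb p b t * marginal r b := by
  induction t using List.reverseRecOn with
  | nil => simpa [condProb] using acceptedMass_le_marginal p r b
  | append_singleton t x ih =>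
    rw [← List.append_assoc, acceptedMass_concat, condProb_concat, mul_right_comm]
    exact (min_le_right _ _).trans (by gcongr)

theorem exists_le_acceptedMass (p : Model V) (r : PMF (Path V L)) (a : List V) :
    ∃ k < a.length + 1,
      condProb p (a.take k) (a.drop k) * marginal r (a.take k) ≤ acceptedMass p r a := by
  induction a using List.reverseRecOn with
  | nil => exact ⟨0, by simp, by simp [condProb, marginal_nil, acceptedMass_nil]⟩
  | append_singleton a x ih =>
    rw [acceptedMass_concat]
    rcases min_choice (marginal r (a ++ [x])) (acceptedMass p r a * (p a x).toReal) with h | h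
    · refine ⟨a.length + 1, by simp, ?_⟩
      rw [h, List.take_of_length_le (by simp), List.drop_of_length_le (by simp)]
      simp [condProb]
    · obtain ⟨k, hk, hle⟩ := ih
      refine ⟨k, by simp; omega, ?_⟩
      rw [h, List.take_append_of_le_length (by omega), List.drop_append_of_le_length (by omega),
        condProb_concat, List.take_append_drop, mul_right_comm]
      gcongr

/-- The recursion for the accepted mass unfolds to the minimum in the objective. -/
theorem inf'_eq_acceptedMass (p : Model V) (r : PMF (Path V L)) {i : ℕ} (a : Path V i) :
    ((Finset.range (i + 1)).inf' Finset.nonempty_range_add_one fun k =>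
      condProb p (pre a k) ((List.ofFn a).drop k) * marginal r (pre a k)) =
      acceptedMass p r (List.ofFn a) := by
  refine le_antisymm ?_ (Finset.le_inf' _ _ fun k _ => ?_)
  · obtain ⟨k, hk, h⟩ := exists_le_acceptedMass p r (List.ofFn a)
    exact (Finset.inf'_le _ (by simpa using hk)).trans h
  · simpa [pre] using acceptedMass_append_le p r ((List.ofFn a).take k) ((List.ofFn a).drop k)

theorem objective_eq_sum (p : Model V) (r : PMF (Path V L)) :
    objective p r = ∑ i ∈ Finset.range (L + 1), ∑ a : Path V i, acceptedMass p r (List.ofFn a) := by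
  simp only [objective, inf'_eq_acceptedMass]

theorem objective_nonneg (p : Model V) (r : PMF (Path V L)) : 0 ≤ objective p r := by
  rw [objective_eq_sum]
  exact Finset.sum_nonneg fun i _ => Finset.sum_nonneg fun a _ => acceptedMass_nonneg p r _

/-- A sequence has exactly one proper prefix of each length below its own. -/
theorem sum_proper_prefix (b : List V) (i : ℕ) :
    (∑ a : Path V i,
      if List.ofFn a <+: b ∧ (List.ofFn a).length < b.length then (1 : ℝ≥0∞) else 0) =
      if i < b.length then 1 else 0 := by
  split_ifs with h
  · have e : List.ofFn (fun j : Fin i => b[(j : ℕ)]) = b.take i :=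
      List.ext_getElem (by simp; omega) fun _ _ _ => by simp
    rw [Finset.sum_eq_single fun j : Fin i => b[(j : ℕ)]]
    · rw [if_pos ⟨e ▸ List.take_prefix i b, by simpa using h⟩]
    · intro a _ ha
      refine if_neg fun ⟨hp, _⟩ => ha (List.ofFn_injective ?_)
      rw [e, List.prefix_iff_eq_take.1 hp, List.length_ofFn]
    · simp
  · simp [h]

/-- The mean length of a random sequence, computed from the probabilities of its proper
prefixes. -/
theorem mean_length_eq_sum {o : PMF (List V)} (ho : ∀ b, o b ≠ 0 → b.length ≤ L + 1) :
    ∑' b, o b * (b.length : ℝ≥0∞) =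
      ∑ i ∈ Finset.range (L + 1), ∑ a : Path V i, strictMass o (List.ofFn a) := by
  unfold strictMass
  simp_rw [← Summable.tsum_finsetSum fun _ _ => ENNReal.summable]
  congr 1; funext b
  by_cases hb : o b = 0
  · simp [hb]
  · have hl := ho b hb
    have h1 : ∀ i, (∑ a : Path V i, if List.ofFn a <+: b ∧ (List.ofFn a).length < b.length
        then o b else 0) = o b * if i < b.length then 1 else 0 := fun i => by
      rw [← sum_proper_prefix, Finset.mul_sum]
      simp
    have h2 : (Finset.range (L + 1)).filter (fun i => i < b.length) = Finset.range b.length := by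
      ext i; simp; omega
    rw [Finset.sum_congr rfl fun i _ => h1 i, ← Finset.mul_sum, Finset.sum_boole, h2,
      Finset.card_range]

theorem sum_ofReal_acceptedMass (p : Model V) (r : PMF (Path V L)) :
    ∑ i ∈ Finset.range (L + 1), ∑ a : Path V i, ENNReal.ofReal (acceptedMass p r (List.ofFn a)) =
      ENNReal.ofReal (objective p r) := by
  rw [objective_eq_sum, ENNReal.ofReal_sum_of_nonneg fun i _ =>
    Finset.sum_nonneg fun a _ => acceptedMass_nonneg p r _]
  refine Finset.sum_congr rfl fun i _ => ?_
  rw [ENNReal.ofReal_sum_of_nonneg fun a _ => acceptedMass_nonneg p r _]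

theorem mean_length_bind_blockVerify (p : Model V) (r : PMF (Path V L)) :
    ∑' b, (r.bind (blockVerify p r)) b * (b.length : ℝ≥0∞) = ENNReal.ofReal (objective p r) := by
  rw [mean_length_eq_sum (length_le_of_bind_blockVerify p r), ← sum_ofReal_acceptedMass]
  refine Finset.sum_congr rfl fun i hi => Finset.sum_congr rfl fun a _ => ?_
  exact (strictMass_bind_blockVerify p r _ (by simp at hi ⊢; omega)).1

/-- Block verification is extremal: a calibrated output whose proper prefixes are dominated by the
prefixes of a path with law `r` extends each `a` with probability at most `acceptedMass p r a`. -/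
theorem IsCalibrated.strictMass_le {p : Model V} {r : PMF (Path V L)} {o : PMF (List V)}
    (h : IsCalibrated p L o) (hr : ∀ a, strictMass o a ≤ ENNReal.ofReal (marginal r a))
    (a : List V) : strictMass o a ≤ ENNReal.ofReal (acceptedMass p r a) := by
  induction a using List.reverseRecOn with
  | nil => simpa [acceptedMass_nil] using strictMass_le_one o []
  | append_singleton a x ih =>
    rw [acceptedMass_concat, ENNReal.ofReal_min]
    refine le_min (hr _) ?_
    by_cases ha : a.length ≤ L
    · calc _ ≤ prefixMass o (a ++ [x]) := le_add_self.trans (prefixMass_eq_add _ _).ge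
        _ = strictMass o a * p a x := h.step a x ha
        _ ≤ _ := by
          rw [ENNReal.ofReal_mul (acceptedMass_nonneg _ _ _),
            ENNReal.ofReal_toReal ((p a).apply_ne_top x)]
          gcongr
    · rw [strictMass_eq_zero h.length_le (by simp; omega)]
      simp

theorem IsCalibrated.mean_length_le {p : Model V} {r : PMF (Path V L)} {o : PMF (List V)}
    (h : IsCalibrated p L o) (hr : ∀ a, strictMass o a ≤ ENNReal.ofReal (marginal r a)) :
    ∑' b, o b * (b.length : ℝ≥0∞) ≤ ENNReal.ofReal (objective p r) := by
  rw [mean_length_eq_sum h.length_le, ← sum_ofReal_acceptedMass]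
  exact Finset.sum_le_sum fun i _ => Finset.sum_le_sum fun a _ => h.strictMass_le hr _

theorem eq_of_sum_le_sum {ι : Type*} {s : Finset ι} {f g : ι → ℝ≥0∞}
    (hle : ∀ i ∈ s, f i ≤ g i) (hf : ∀ i ∈ s, f i ≠ ⊤) (h : ∑ i ∈ s, g i ≤ ∑ i ∈ s, f i) :
    ∀ i ∈ s, f i = g i := by
  classical
  intro i hi
  refine le_antisymm (hle i hi) ?_
  rw [← Finset.add_sum_erase s f hi, ← Finset.add_sum_erase s g hi] at h
  have he : ∑ j ∈ s.erase i, f j ≤ ∑ j ∈ s.erase i, g j :=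
    Finset.sum_le_sum fun j hj => hle j (Finset.mem_of_mem_erase hj)
  have ht : ∑ j ∈ s.erase i, f j ≠ ⊤ :=
    ENNReal.sum_ne_top.2 fun j hj => hf j (Finset.mem_of_mem_erase hj)
  exact (ENNReal.add_le_add_iff_right ht).1 ((add_le_add_right he _).trans h)

/-- Equality in `IsCalibrated.mean_length_le` forces equality of all prefix probabilities. -/
theorem IsCalibrated.eq_bind_blockVerify {p : Model V} {r : PMF (Path V L)} {o : PMF (List V)}
    (h : IsCalibrated p L o) (hr : ∀ a, strictMass o a ≤ ENNReal.ofReal (marginal r a))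
    (he : ENNReal.ofReal (objective p r) ≤ ∑' b, o b * (b.length : ℝ≥0∞)) :
    o = r.bind (blockVerify p r) := by
  refine h.eq_of_strictMass_eq (isCalibrated_bind_blockVerify p r) fun a ha => ?_
  rw [(strictMass_bind_blockVerify p r a ha).1]
  rw [mean_length_eq_sum h.length_le, ← sum_ofReal_acceptedMass] at he
  have hle : ∀ a, strictMass o a ≤ ENNReal.ofReal (acceptedMass p r a) := h.strictMass_le hr
  have h1 := eq_of_sum_le_sum (fun i _ => Finset.sum_le_sum fun b _ => hle (List.ofFn b))
    (fun i _ => ENNReal.sum_ne_top.2 fun b _ => strictMass_ne_top o _) he a.length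
    (by simp; omega)
  have h2 := eq_of_sum_le_sum (fun b _ => hle (List.ofFn b)) (fun b _ => strictMass_ne_top o _)
    h1.ge (fun j : Fin a.length => a.get j) (Finset.mem_univ _)
  rwa [List.ofFn_get] at h2

theorem ofReal_marginal (r : PMF (Path V L)) (a : List V) :
    ENNReal.ofReal (marginal r a) = r.toOuterMeasure {Y | a <+: List.ofFn Y} := by
  rw [marginal, ENNReal.ofReal_sum_of_nonneg fun _ _ => ENNReal.toReal_nonneg,
    PMF.toOuterMeasure_apply, tsum_fintype, Finset.sum_filter]
  refine Finset.sum_congr rfl fun Y _ => ?_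
  by_cases h : a <+: List.ofFn Y
  · rw [if_pos h, Set.indicator_of_mem (by exact h), ENNReal.ofReal_toReal (r.apply_ne_top Y)]
  · rw [if_neg h, Set.indicator_of_notMem (by exact h)]

theorem strictMass_eq_toOuterMeasure {V : Type*} [DecidableEq V] (o : PMF (List V)) (a : List V) :
    strictMass o a = o.toOuterMeasure {b | a <+: b ∧ a.length < b.length} := by
  rw [strictMass, PMF.toOuterMeasure_apply]
  congr 1; funext b
  simp [Set.indicator_apply]

/-- Selecting a draft that matches the output of a prefix-matching algorithm gives a path law that
dominates the proper prefixes of that output. -/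
theorem exists_selection_dominating (hK : 1 ≤ K) (q : PMF (Path V L))
    (F : (Fin K → Path V L) → PMF (List V))
    (hF : ∀ X, iid q K X ≠ 0 → ∀ o, F X o ≠ 0 →
      ∃ k : Fin K, ∃ τ ≤ L, ∃ y : V, o = pre (X k) τ ++ [y]) :
    ∃ γ : (Fin K → Path V L) → PMF (Fin K), ∀ a,
      strictMass ((iid q K).bind F) a ≤ ENNReal.ofReal (marginal (skewed q γ) a) := by
  classical
  -- `κ X o` is the index of a draft that matches the output `o`; off the support of the output
  -- it is immaterial.
  let κ : (Fin K → Path V L) → List V → Fin K := fun X o =>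
    if h : ∃ k : Fin K, ∃ τ ≤ L, ∃ y : V, o = pre (X k) τ ++ [y] then h.choose else ⟨0, hK⟩
  refine ⟨fun X => (F X).map (κ X), fun a => ?_⟩
  rw [ofReal_marginal, strictMass_eq_toOuterMeasure, skewed, PMF.toOuterMeasure_bind_apply,
    PMF.toOuterMeasure_bind_apply]
  refine ENNReal.tsum_le_tsum fun X => ?_
  by_cases hX : iid q K X = 0
  · simp [hX]
  gcongr
  rw [PMF.toOuterMeasure_map_apply, PMF.toOuterMeasure_map_apply]
  refine PMF.toOuterMeasure_mono _ ?_
  rintro o ⟨⟨hp, hl⟩, ho⟩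
  have h := hF X hX o ((PMF.mem_support_iff _ _).1 ho)
  obtain ⟨τ, -, y, e⟩ := h.choose_spec
  have hk : κ X o = h.choose := dif_pos h
  show a <+: List.ofFn (X (κ X o))
  rw [hk]
  rw [e] at hp hl
  refine (List.prefix_of_prefix_length_le hp (List.prefix_append _ _) ?_).trans
    (List.take_prefix _ _)
  simp at hl; omega

end Efficiency

/-! ### Skewed draft distributions -/

theorem intervalIntegrable_sum_tail {ι : Type*} [Fintype ι] (w c : ι → ℝ) (A B : ℝ) :
    IntervalIntegrable (fun t => ∑ i with t ≤ c i, w i) MeasureTheory.volume A B := by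
  have h1 : ∀ i, IntervalIntegrable (fun t => w i * if t ≤ c i then (1 : ℝ) else 0)
      MeasureTheory.volume A B := fun i => by
    refine (Antitone.intervalIntegrable fun s t hst => ?_).const_mul _
    split_ifs <;> linarith
  have h2 := IntervalIntegrable.sum Finset.univ fun i _ => h1 i
  have h3 : (∑ i, fun t => w i * if t ≤ c i then (1 : ℝ) else 0) =
      fun t => ∑ i with t ≤ c i, w i := by
    funext t
    simp [Finset.sum_filter]
  rwa [h3] at h2

/-- The layer-cake formula for a finite weighted sum. -/
theorem sum_mul_eq_integral_tail {ι : Type*} [Fintype ι] (w c : ι → ℝ) {A B : ℝ}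
    (hc : ∀ i, c i ∈ Set.Icc A B) :
    ∑ i, w i * c i = A * ∑ i, w i + ∫ t in A..B, ∑ i with t ≤ c i, w i := by
  have h1 : ∀ i, ∫ t in A..B, (if t ≤ c i then w i else 0) = w i * (c i - A) := fun i => by
    have := intervalIntegral.integral_indicator (f := fun _ => w i)
      (μ := MeasureTheory.volume) (hc i)
    simp only [Set.indicator_apply, Set.mem_ofPred_eq] at this
    rw [this, intervalIntegral.integral_const, smul_eq_mul]
    ring
  have h2 : ∀ i, IntervalIntegrable (fun t => if t ≤ c i then w i else 0)
      MeasureTheory.volume A B := fun i => by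
    have := intervalIntegrable_sum_tail (fun _ : Unit => w i) (fun _ => c i) A B
    simpa only [Finset.sum_filter, Finset.univ_unique, Finset.sum_singleton] using this
  simp_rw [Finset.sum_filter]
  rw [intervalIntegral.integral_finsetSum fun i _ => h2 i, Finset.sum_congr rfl
    fun i _ => h1 i, Finset.mul_sum, ← Finset.sum_add_distrib]
  exact Finset.sum_congr rfl fun i _ => by ring

/-- A domination of all upper tails gives a domination of the means. -/
theorem sum_mul_le_sum_mul_of_tail_le {α β : Type*} [Fintype α] [Fintype β] (u f : α → ℝ)
    (v g : β → ℝ) (hs : ∑ a, u a = ∑ b, v b)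
    (h : ∀ t, ∑ a with t ≤ f a, u a ≤ ∑ b with t ≤ g b, v b) :
    ∑ a, u a * f a ≤ ∑ b, v b * g b := by
  obtain ⟨B, hB⟩ := ((Set.finite_range f).union (Set.finite_range g)).isBounded.subset_closedBall 0
  have hf : ∀ a, f a ∈ Set.Icc (-|B|) |B| := fun a => by
    have : |f a| ≤ B := by simpa using hB (Or.inl ⟨a, rfl⟩)
    exact abs_le.1 (this.trans (le_abs_self B))
  have hg : ∀ b, g b ∈ Set.Icc (-|B|) |B| := fun b => by
    have : |g b| ≤ B := by simpa using hB (Or.inr ⟨b, rfl⟩)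
    exact abs_le.1 (this.trans (le_abs_self B))
  rw [sum_mul_eq_integral_tail u f hf, sum_mul_eq_integral_tail v g hg, hs]
  gcongr
  exact intervalIntegral.integral_mono (neg_le_self (abs_nonneg B))
    (intervalIntegrable_sum_tail u f _ _) (intervalIntegrable_sum_tail v g _ _) h

theorem exists_pmf_of_mem_stdSimplex {ι : Type*} [Fintype ι] {x : ι → ℝ}
    (hx : x ∈ stdSimplex ℝ ι) : ∃ m : PMF ι, ∀ i, (m i).toReal = x i := by
  refine ⟨PMF.ofFintype (fun i => ENNReal.ofReal (x i)) ?_, fun i => ?_⟩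
  · rw [← ENNReal.ofReal_sum_of_nonneg fun i _ => hx.1 i, hx.2, ENNReal.ofReal_one]
  · simp [hx.1 i]

theorem toReal_mem_stdSimplex {ι : Type*} [Fintype ι] (m : PMF ι) :
    (fun i => (m i).toReal) ∈ stdSimplex ℝ ι :=
  ⟨fun _ => ENNReal.toReal_nonneg, sum_toReal m⟩

theorem pmf_ext_toReal {ι : Type*} {m m' : PMF ι} (h : ∀ i, (m i).toReal = (m' i).toReal) :
    m = m' := by
  ext i
  exact (ENNReal.toReal_eq_toReal_iff' (m.apply_ne_top i) (m'.apply_ne_top i)).1 (h i)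

section Selection

variable {V : Type*} [Fintype V] [DecidableEq V] {L K : ℕ}

/-- The probability that all `K` independent samples avoid `T`. -/
theorem sum_iid_avoid (q : PMF (Path V L)) (T : Finset (Path V L)) :
    ∑ X : Fin K → Path V L with ∀ k, X k ∉ T, (iid q K X).toReal =
      (1 - ∑ a ∈ T, (q a).toReal) ^ K := by
  have h1 : 1 - ∑ a ∈ T, (q a).toReal = ∑ a ∈ Tᶜ, (q a).toReal := by
    rw [← sum_toReal q, ← Finset.sum_add_sum_compl T]; ring
  have h2 : (Finset.univ.filter fun X : Fin K → Path V L => ∀ k, X k ∉ T) =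
      Fintype.piFinset fun _ => Tᶜ := by
    ext X; simp
  have h3 := Finset.prod_univ_sum (fun _ : Fin K => Tᶜ) fun _ a => (q a).toReal
  rw [h1, h2]
  simp only [Finset.prod_const, Finset.card_univ, Fintype.card_fin] at h3
  rw [h3]
  exact Finset.sum_congr rfl fun X _ => by simp [iid, ENNReal.toReal_prod]

/-- The law of the selected draft as a vector, as a linear function of the selection
probabilities `M X k` of the index `k` given the drafts `X`. -/
def skewedVec (q : PMF (Path V L)) (M : (Fin K → Path V L) → Fin K → ℝ) : Path V L → ℝ :=
  fun Y => ∑ X, (iid q K X).toReal * ∑ k, if X k = Y then M X k else 0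

theorem toReal_skewed (q : PMF (Path V L)) (γ : (Fin K → Path V L) → PMF (Fin K)) (Y : Path V L) :
    (skewed q γ Y).toReal = skewedVec q (fun X k => (γ X k).toReal) Y := by
  rw [skewed, PMF.bind_apply, tsum_fintype, ENNReal.toReal_sum fun X _ =>
    ENNReal.mul_ne_top (PMF.apply_ne_top _ _) (PMF.apply_ne_top _ _), skewedVec]
  refine Finset.sum_congr rfl fun X _ => ?_
  rw [ENNReal.toReal_mul, PMF.map_apply, tsum_fintype, ENNReal.toReal_sum]
  · congr 1
    refine Finset.sum_congr rfl fun k _ => ?_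
    by_cases h : X k = Y
    · simp [h]
    · simp [h, Ne.symm h]
  · intro k _
    split_ifs
    · exact PMF.apply_ne_top _ _
    · simp

theorem sum_mul_skewedVec (q : PMF (Path V L)) (M : (Fin K → Path V L) → Fin K → ℝ)
    (c : Path V L → ℝ) :
    ∑ Y, skewedVec q M Y * c Y = ∑ X, (iid q K X).toReal * ∑ k, M X k * c (X k) := by
  simp_rw [skewedVec, Finset.sum_mul]
  rw [Finset.sum_comm]
  refine Finset.sum_congr rfl fun X _ => ?_
  simp_rw [mul_assoc, ← Finset.mul_sum, Finset.sum_mul]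
  rw [Finset.sum_comm]
  simp

/-- The set of laws of selected drafts, as vectors. -/
def skewedSet (K : ℕ) (q : PMF (Path V L)) : Set (Path V L → ℝ) :=
  skewedVec q '' Set.univ.pi fun _ : Fin K → Path V L => stdSimplex ℝ (Fin K)

theorem mem_skewedSet_iff (q : PMF (Path V L)) (v : Path V L → ℝ) :
    v ∈ skewedSet K q ↔
      ∃ γ : (Fin K → Path V L) → PMF (Fin K), (fun Y => (skewed q γ Y).toReal) = v := by
  constructor
  · rintro ⟨M, hM, rfl⟩
    choose γ hγ using fun X => exists_pmf_of_mem_stdSimplex (hM X (Set.mem_univ X))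
    refine ⟨γ, ?_⟩
    funext Y
    simp_rw [toReal_skewed, hγ]
  · rintro ⟨γ, rfl⟩
    exact ⟨fun X k => (γ X k).toReal, fun X _ => toReal_mem_stdSimplex _,
      funext fun Y => (toReal_skewed q γ Y).symm⟩

theorem isCompact_skewedSet (q : PMF (Path V L)) : IsCompact (skewedSet K q) := by
  refine (isCompact_univ_pi fun _ => isCompact_stdSimplex ℝ _).image (continuous_pi fun Y => ?_)
  refine continuous_finsetSum _ fun X _ => continuous_const.mul
    (continuous_finsetSum _ fun k _ => ?_)
  split_ifs <;> fun_prop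

theorem convex_skewedSet (q : PMF (Path V L)) : Convex ℝ (skewedSet K q) := by
  refine (convex_pi fun _ _ => convex_stdSimplex ℝ _).is_linear_image ⟨fun M N => ?_, fun c M => ?_⟩
  · funext Y
    simp only [skewedVec, Pi.add_apply, ← Finset.sum_add_distrib, ← mul_add]
    refine Finset.sum_congr rfl fun X _ => congrArg _ (Finset.sum_congr rfl fun k _ => ?_)
    split_ifs <;> simp
  · funext Y
    simp only [skewedVec, Pi.smul_apply, smul_eq_mul, Finset.mul_sum]
    refine Finset.sum_congr rfl fun X _ => Finset.sum_congr rfl fun k _ => ?_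
    split_ifs
    · ring
    · simp

theorem feasible_skewed (q : PMF (Path V L)) (γ : (Fin K → Path V L) → PMF (Fin K)) :
    Feasible K q (skewed q γ) := by
  intro T
  have h1 := sum_mul_skewedVec q (fun X k => (γ X k).toReal) fun Y => if Y ∈ T then 0 else 1
  simp_rw [← toReal_skewed] at h1
  have h2 : 1 - ∑ a ∈ T, (skewed q γ a).toReal =
      ∑ Y, (skewed q γ Y).toReal * if Y ∈ T then 0 else 1 := by
    have h3 := Finset.sum_filter_add_sum_filter_not Finset.univ (· ∈ T) fun Y =>
      (skewed q γ Y).toReal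
    rw [sum_toReal, Finset.filter_univ_mem] at h3
    rw [sub_eq_of_eq_add' h3.symm, Finset.sum_filter]
    exact Finset.sum_congr rfl fun Y _ => by by_cases hY : Y ∈ T <;> simp [hY]
  rw [h2, h1, ← sum_iid_avoid, Finset.sum_filter]
  refine Finset.sum_le_sum fun X _ => ?_
  split_ifs with hX
  · simp [hX, sum_toReal]
  · exact mul_nonneg ENNReal.toReal_nonneg (Finset.sum_nonneg fun k _ =>
      mul_nonneg ENNReal.toReal_nonneg (by split_ifs <;> norm_num))

/-- A fractional marriage theorem. If `r` were not the law of a selected draft, a linear functional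
would separate it from all of these laws; but among them is the law of the draft that maximizes the
functional, and by the constraints it dominates `r` on all upper level sets of the functional. -/
theorem mem_skewedSet_of_feasible (hK : 1 ≤ K) {q r : PMF (Path V L)} (h : Feasible K q r) :
    (fun Y => (r Y).toReal) ∈ skewedSet K q := by
  by_contra hr
  obtain ⟨f, u, hu, hfr⟩ := geometric_hahn_banach_closed_point (convex_skewedSet (K := K) q)
    (isCompact_skewedSet q).isClosed hr
  have hf : ∀ v : Path V L → ℝ, f v = ∑ Y, v Y * f (Pi.single Y 1) := fun v => by
    have := LinearMap.pi_apply_eq_sum_univ f.toLinearMap v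
    simp only [smul_eq_mul] at this
    refine this.trans (Finset.sum_congr rfl fun Y _ => ?_)
    have hs : (fun Z => if Y = Z then (1 : ℝ) else 0) = Pi.single Y 1 := by
      funext Z
      simp [Pi.single_apply, eq_comm]
    rw [hs]
    rfl
  -- `c` is the separating functional, and `κ X` is the index of the draft that maximizes it.
  set c : Path V L → ℝ := fun Y => f (Pi.single Y 1)
  have : Nonempty (Fin K) := ⟨⟨0, hK⟩⟩
  choose κ hκ using fun X : Fin K → Path V L => Finite.exists_max fun k => c (X k)
  have hM := hu (skewedVec q fun X => Pi.single (κ X) 1)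
    ⟨_, fun X _ => single_mem_stdSimplex ℝ (κ X), rfl⟩
  rw [hf, sum_mul_skewedVec] at hM
  have e : ∀ X : Fin K → Path V L,
      ∑ k, (Pi.single (κ X) 1 : Fin K → ℝ) k * c (X k) = c (X (κ X)) := fun X => by
    simp [Pi.single_apply]
  have hM : ∑ X, (iid q K X).toReal * c (X (κ X)) < u :=
    lt_of_eq_of_lt (Finset.sum_congr rfl fun X _ => by rw [← e X]) hM
  rw [hf] at hfr
  refine absurd (sum_mul_le_sum_mul_of_tail_le (fun Y => (r Y).toReal) c
    (fun X => (iid q K X).toReal) (fun X => c (X (κ X))) ?_ fun t => ?_) (not_le.2 (hM.trans hfr))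
  · rw [sum_toReal, sum_toReal]
  · have h1 := h (Finset.univ.filter fun Y => t ≤ c Y)
    rw [← sum_iid_avoid] at h1
    have h2 : (Finset.univ.filter fun X : Fin K → Path V L =>
        ∀ k, X k ∉ Finset.univ.filter fun Y => t ≤ c Y) =
        Finset.univ.filter fun X => ¬ t ≤ c (X (κ X)) := by
      ext X
      simp only [Finset.mem_filter, Finset.mem_univ, true_and, not_le]
      exact ⟨fun h => h _, fun h k => (hκ X k).trans_lt h⟩
    rw [h2] at h1
    have h3 := Finset.sum_filter_add_sum_filter_not Finset.univ
      (fun X : Fin K → Path V L => t ≤ c (X (κ X))) fun X => (iid q K X).toReal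
    rw [sum_toReal] at h3
    linarith

/-- The feasible points are the laws of selected drafts. -/
theorem feasible_iff (hK : 1 ≤ K) (q r : PMF (Path V L)) :
    Feasible K q r ↔ ∃ γ : (Fin K → Path V L) → PMF (Fin K), skewed q γ = r := by
  constructor
  · intro h
    obtain ⟨γ, hγ⟩ := (mem_skewedSet_iff q _).1 (mem_skewedSet_of_feasible hK h)
    exact ⟨γ, pmf_ext_toReal fun Y => congrFun hγ Y⟩
  · rintro ⟨γ, rfl⟩
    exact feasible_skewed q γ

theorem exists_objective_max (hK : 1 ≤ K) (p : Model V) (q : PMF (Path V L)) :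
    ∃ γ : (Fin K → Path V L) → PMF (Fin K),
      ∀ γ' : (Fin K → Path V L) → PMF (Fin K),
        objective p (skewed q γ') ≤ objective p (skewed q γ) := by
  let obj : (Path V L → ℝ) → ℝ := fun v =>
    ∑ i ∈ Finset.range (L + 1), ∑ a : Path V i,
      (Finset.range (i + 1)).inf' Finset.nonempty_range_add_one fun k =>
        condProb p (pre a k) ((List.ofFn a).drop k) *
          ∑ X : Path V L with pre a k <+: List.ofFn X, v X
  have hobj : Continuous obj :=
    continuous_finsetSum _ fun i _ => continuous_finsetSum _ fun a _ =>
      Continuous.finset_inf'_apply _ fun k _ => continuous_const.mul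
        (continuous_finsetSum _ fun X _ => continuous_apply X)
  have hne : (skewedSet K q).Nonempty :=
    ⟨_, (mem_skewedSet_iff q _).2 ⟨fun _ => PMF.pure ⟨0, hK⟩, rfl⟩⟩
  obtain ⟨v, hv, hmax⟩ := (isCompact_skewedSet q).exists_isMaxOn hne hobj.continuousOn
  obtain ⟨γ, rfl⟩ := (mem_skewedSet_iff q v).1 hv
  exact ⟨γ, fun γ' => hmax ((mem_skewedSet_iff q _).2 ⟨γ', rfl⟩)⟩

end Selection

/-! ### Verification algorithms and selection rules -/

/-- A model with the same next-token distributions as `p` after at most `L` tokens, which depends on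
these distributions only. -/
def truncate {V : Type*} (L : ℕ) (p : Model V) : Model V :=
  fun a => if a.length ≤ L then p a else p []

theorem agreeUpTo_truncate {V : Type*} (L : ℕ) (p : Model V) : AgreeUpTo L (truncate L p) p :=
  fun _ ha => if_pos ha

theorem truncate_congr {V : Type*} {L : ℕ} {p p' : Model V} (h : AgreeUpTo L p p') :
    truncate L p = truncate L p' := by
  funext a
  unfold truncate
  split_ifs with ha
  · exact h a ha
  · exact h [] (Nat.zero_le L)

/-- The selection rule that applies the selection `S p q` to the truncation of the target. -/
def SelectionRule.ofTruncate {V : Type*} {L K : ℕ}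
    (S : Model V → PMF (Path V L) → (Fin K → Path V L) → PMF (Fin K)) : SelectionRule V L K where
  select p q := S (truncate L p) q
  select_congr p p' q h := by rw [truncate_congr h]

section Algorithms

variable {V : Type*} [Fintype V] [DecidableEq V] {L K : ℕ}

theorem objective_congr {p p' : Model V} (h : AgreeUpTo L p p') (r : PMF (Path V L)) :
    objective p r = objective p' r := by
  rw [objective_eq_sum, objective_eq_sum]
  refine Finset.sum_congr rfl fun i hi => Finset.sum_congr rfl fun a _ => ?_
  rw [acceptedMass, acceptedMass, weight_congr h]
  simp at hi ⊢; omega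

theorem VerificationAlg.Valid.isCalibrated {Φ : VerificationAlg V L K} (h : Φ.Valid) (p : Model V)
    (q : PMF (Path V L)) : IsCalibrated p L (Φ.outputLaw p q) := by
  refine (isCalibrated_iff p L _).2 ⟨fun b hb => ?_, h.2 p q⟩
  rw [← PMF.mem_support_iff, VerificationAlg.outputLaw, PMF.mem_support_bind_iff] at hb
  obtain ⟨X, hX, hb⟩ := hb
  obtain ⟨k, τ, hτ, y, rfl⟩ := h.1 p q X ((PMF.mem_support_iff _ _).1 hX) b
    ((PMF.mem_support_iff _ _).1 hb)
  simp [length_pre hτ, hτ]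

theorem VerificationAlg.Valid.exists_dominating (hK : 1 ≤ K) {Φ : VerificationAlg V L K}
    (h : Φ.Valid) (p : Model V) (q : PMF (Path V L)) :
    ∃ γ : (Fin K → Path V L) → PMF (Fin K), ∀ a,
      strictMass (Φ.outputLaw p q) a ≤ ENNReal.ofReal (marginal (skewed q γ) a) :=
  exists_selection_dominating hK q (Φ.run p q) (h.1 p q)

theorem SelectionRule.outputLaw_thenBlockVerify (Γ : SelectionRule V L K) (p : Model V)
    (q : PMF (Path V L)) : Γ.thenBlockVerify.outputLaw p q =
      (Γ.skewedDraft p q).bind (blockVerify p (Γ.skewedDraft p q)) := by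
  conv_rhs => enter [1]; rw [SelectionRule.skewedDraft, skewed]
  rw [PMF.bind_bind]
  simp_rw [PMF.bind_map]
  rfl

theorem SelectionRule.valid_thenBlockVerify (Γ : SelectionRule V L K) :
    Γ.thenBlockVerify.Valid := by
  constructor
  · intro p q X _ o ho
    rw [← PMF.mem_support_iff, SelectionRule.thenBlockVerify, PMF.mem_support_bind_iff] at ho
    obtain ⟨k, -, ho⟩ := ho
    exact ⟨k, blockVerify_support p _ _ ((PMF.mem_support_iff _ _).1 ho)⟩
  · intro p q
    rw [Γ.outputLaw_thenBlockVerify]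
    exact ((isCalibrated_iff p L _).1 (isCalibrated_bind_blockVerify p _)).2

theorem SelectionRule.blockEfficiency_thenBlockVerify (Γ : SelectionRule V L K) (p : Model V)
    (q : PMF (Path V L)) : Γ.thenBlockVerify.blockEfficiency p q =
      ENNReal.ofReal (objective p (Γ.skewedDraft p q)) := by
  rw [VerificationAlg.blockEfficiency, Γ.outputLaw_thenBlockVerify, mean_length_bind_blockVerify]

theorem SelectionRule.isOptimal_thenBlockVerify_iff (hK : 1 ≤ K) (Γ : SelectionRule V L K) :
    Γ.thenBlockVerify.IsOptimal ↔ ∀ (p : Model V) (q : PMF (Path V L)),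
      Feasible K q (Γ.skewedDraft p q) ∧
        IsMaxOn (objective p) {r | Feasible K q r} (Γ.skewedDraft p q) := by
  constructor
  · refine fun h p q => ⟨feasible_skewed q _, fun r hr => ?_⟩
    obtain ⟨γ, rfl⟩ := (feasible_iff hK q r).1 hr
    -- A competitor at this one `p, q` extends to the rule that uses `γ` for every target and draft.
    let Γ' : SelectionRule V L K := ⟨fun _ _ => γ, fun _ _ _ _ => rfl⟩
    have h1 := h.2 _ Γ'.valid_thenBlockVerify p q
    rw [Γ.blockEfficiency_thenBlockVerify, Γ'.blockEfficiency_thenBlockVerify] at h1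
    exact (ENNReal.ofReal_le_ofReal_iff (objective_nonneg p _)).1 h1
  · refine fun h => ⟨Γ.valid_thenBlockVerify, fun Ψ hΨ p q => ?_⟩
    obtain ⟨γ, hγ⟩ := hΨ.exists_dominating hK p q
    rw [Γ.blockEfficiency_thenBlockVerify]
    exact ((hΨ.isCalibrated p q).mean_length_le hγ).trans
      (ENNReal.ofReal_le_ofReal ((h p q).2 (feasible_skewed q γ)))

theorem exists_isOptimal_thenBlockVerify (hK : 1 ≤ K) :
    ∃ Γ : SelectionRule V L K, Γ.thenBlockVerify.IsOptimal := by
  choose S hS using exists_objective_max (V := V) (L := L) hK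
  refine ⟨.ofTruncate S, (SelectionRule.isOptimal_thenBlockVerify_iff hK _).2 fun p q =>
    ⟨feasible_skewed q _, fun r hr => ?_⟩⟩
  obtain ⟨γ, rfl⟩ := (feasible_iff hK q r).1 hr
  show objective p (skewed q γ) ≤ objective p (skewed q (S (truncate L p) q))
  simp_rw [← objective_congr (agreeUpTo_truncate L p)]
  exact hS _ q γ

theorem VerificationAlg.outputLaw_truncate {V : Type*} [Fintype V] {L K : ℕ}
    (Φ : VerificationAlg V L K) (p : Model V) (q : PMF (Path V L)) :
    Φ.outputLaw (truncate L p) q = Φ.outputLaw p q := by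
  rw [VerificationAlg.outputLaw, Φ.run_congr _ _ q (agreeUpTo_truncate L p),
    VerificationAlg.outputLaw]

/-- An optimal algorithm is at least as efficient as block verification after the selection of the
draft that matches its own output, so the bound on its efficiency is attained. -/
theorem VerificationAlg.IsOptimal.exists_outputLaw_eq (hK : 1 ≤ K) {Φ : VerificationAlg V L K}
    (h : Φ.IsOptimal) (p : Model V) (q : PMF (Path V L)) :
    ∃ γ : (Fin K → Path V L) → PMF (Fin K),
      Φ.outputLaw p q = (skewed q γ).bind (blockVerify p (skewed q γ)) := by
  obtain ⟨γ, hγ⟩ := h.1.exists_dominating hK p q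
  let Γ : SelectionRule V L K := ⟨fun _ _ => γ, fun _ _ _ _ => rfl⟩
  have h1 := h.2 _ Γ.valid_thenBlockVerify p q
  rw [Γ.blockEfficiency_thenBlockVerify] at h1
  exact ⟨γ, (h.1.isCalibrated p q).eq_bind_blockVerify hγ h1⟩

/-- The selections are chosen at truncated targets, so that they depend on the `L`-step target
probabilities only, as a selection rule has to. -/
theorem VerificationAlg.IsOptimal.exists_selectionRule (hK : 1 ≤ K) {Φ : VerificationAlg V L K}
    (h : Φ.IsOptimal) : ∃ Γ : SelectionRule V L K, Γ.thenBlockVerify.IsOptimal ∧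
      ∀ (p : Model V) (q : PMF (Path V L)),
        Φ.outputLaw p q = Γ.thenBlockVerify.outputLaw p q := by
  choose S hS using h.exists_outputLaw_eq hK
  have he : ∀ (p : Model V) (q : PMF (Path V L)),
      Φ.outputLaw p q = (SelectionRule.ofTruncate S).thenBlockVerify.outputLaw p q := fun p q => by
    rw [← Φ.outputLaw_truncate, hS, SelectionRule.outputLaw_thenBlockVerify]
    exact congrArg _ (funext fun X => blockVerify_congr (agreeUpTo_truncate L p) _ X)
  refine ⟨_, ⟨SelectionRule.valid_thenBlockVerify _, fun Ψ hΨ p q => ?_⟩, he⟩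
  have h1 := h.2 Ψ hΨ p q
  simp only [VerificationAlg.blockEfficiency, he] at h1
  exact h1

end Algorithms

end

end SpecDec

theorem mainTheorem4 {V : Type*} [Fintype V] [DecidableEq V] (L K : ℕ) (hK : 1 ≤ K) :
    -- selection followed by block verification with the skewed draft is always valid
    (∀ Γ : SpecDec.SelectionRule V L K, Γ.thenBlockVerify.Valid) ∧
    -- for some rule it is optimal among all valid algorithms
    (∃ Γ : SpecDec.SelectionRule V L K, Γ.thenBlockVerify.IsOptimal) ∧
    -- every optimal algorithm is of this form, up to the law of its output
    (∀ Φ : SpecDec.VerificationAlg V L K, Φ.IsOptimal →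
      ∃ Γ : SpecDec.SelectionRule V L K, Γ.thenBlockVerify.IsOptimal ∧
        ∀ (p : SpecDec.Model V) (q : PMF (SpecDec.Path V L)),
          Φ.outputLaw p q = Γ.thenBlockVerify.outputLaw p q) ∧
    -- the feasible points are exactly the skewed draft distributions
    (∀ q r : PMF (SpecDec.Path V L), SpecDec.Feasible K q r ↔
      ∃ γ : (Fin K → SpecDec.Path V L) → PMF (Fin K), SpecDec.skewed q γ = r) ∧
    -- the objective is the block efficiency
    (∀ (Γ : SpecDec.SelectionRule V L K) (p : SpecDec.Model V) (q : PMF (SpecDec.Path V L)),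
      Γ.thenBlockVerify.blockEfficiency p q =
        ENNReal.ofReal (SpecDec.objective p (Γ.skewedDraft p q))) ∧
    -- the optimal rules are those whose skewed draft distribution solves the optimization problem
    (∀ Γ : SpecDec.SelectionRule V L K, Γ.thenBlockVerify.IsOptimal ↔
      ∀ (p : SpecDec.Model V) (q : PMF (SpecDec.Path V L)),
        SpecDec.Feasible K q (Γ.skewedDraft p q) ∧
        IsMaxOn (SpecDec.objective p) {r | SpecDec.Feasible K q r} (Γ.skewedDraft p q)) := by
  exact ⟨fun Γ => Γ.valid_thenBlockVerify, SpecDec.exists_isOptimal_thenBlockVerify hK,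
    fun Φ h => h.exists_selectionRule hK, SpecDec.feasible_iff hK,
    fun Γ => Γ.blockEfficiency_thenBlockVerify,
    fun Γ => Γ.isOptimal_thenBlockVerify_iff hK⟩
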